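/- Let $r\ge 3$ and let $A=(a_1,\dots,a_r)$ be a tuple of integers $a_i\ge 2$; put $\chi_A:=2+\sum_{i=1}^r\left(\frac1{a_i}-1\right)$. Root systems. The star quiver $\mathbb T_A$ has vertices $1$ and $(i,j)$ ($1\le i\le r$, $1\le j\le a_i-1$) and arrows $f_{i,1}:1\to(i,1)$ and $f_{i,j}:(i,j-1)\to(i,j)$ for $j\ge2$. The octopus $\widetilde{\mathbb T}_A$ has one more vertex $1^*$, the additional arrows $(i,1)\to 1^*$ ($1\le i\le r$), and two relations from $1$ to $1^*$. For either of these bound quivers let the root lattice be the free abelian group on the vertices, with basis the simple roots $\alpha_v$ (resp. $\widetilde\alpha_v$), let $\chi(\alpha_v,\alpha_w)=\delta_{vw}-\#\{\text{arrows }v\to w\}+\#\{\text{relations from }v\text{ to }w\}$ be its Euler form and $I(x,y)=\chi(x,y)+\chi(y,x)$ its Cartan form. (These are the Grothendieck group of the bounded derived category of the bound quiver algebra, the classes of the simple modules, and the symmetrized Euler form.) The real roots are the images of the simple roots under the group generated by the reflections $r_{\alpha_v}$, where $r_\alpha(\lambda)=\lambda-I(\lambda,\alpha)\alpha$, and the Weyl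 group is generated by the reflections $r_\alpha$ in all real roots $\alpha$. Write $R_A$, $\widetilde R_A$ for the root systems of $\mathbb T_A$, $\widetilde{\mathbb T}_A$, write $K_0(R_A)$ for the root lattice of $R_A$ and $W(R_A)$, $W(\widetilde R_A)$ for the Weyl groups. Put $r_v=r_{\alpha_v}$ and $\widetilde r_v=r_{\widetilde\alpha_v}$. Let $W(\widetilde T_A)$ be the group with generators $\widetilde w_v$, $v$ a vertex of the octopus, and relations (W0) $\widetilde w_v^2=1$ for all $v$; (W1.0) $\widetilde w_v\widetilde w_{v'}=\widetilde w_{v'}\widetilde w_v$ if $I(\widetilde\alpha_v,\widetilde\alpha_{v'})=0$; (W1.1) $\widetilde w_v\widetilde w_{v'}\widetilde w_v=\widetilde w_{v'}\widetilde w_v\widetilde w_{v'}$ if $I(\widetilde\alpha_v,\widetilde\alpha_{v'})=-1$; (W2) $\widetilde w_{(i,1)}\sigma_1\widetilde w_{(i,1)}\sigma_1=\sigma_1\widetilde w_{(i,1)}\sigma_1\widetilde w_{(i,1)}$ for $1\le i\le r$; (W3) $\widetilde w_{(i,1)}\sigma_{(j,1)}=\sigma_{(j,1)}\widetilde w_{(i,1)}$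 and $\widetilde w_{(j,1)}\sigma_{(i,1)}=\sigma_{(i,1)}\widetilde w_{(j,1)}$ for $1\le i<j\le r$; where $\sigma_1:=\widetilde w_1\widetilde w_{1^*}$ and $\sigma_{(i,1)}:=\widetilde w_{(i,1)}\sigma_1\widetilde w_{(i,1)}\sigma_1^{-1}$. Theorem. There is an isomorphism of groups $$\Phi: W(\widetilde T_A)\;\xrightarrow{\ \cong\ }\; W(R_A)\ltimes K_0(R_A)$$ (semidirect product for the natural action of $W(R_A)$ on $K_0(R_A)$) with $\Phi(\widetilde w_v)=r_v$ for all vertices $v$ of $\mathbb T_A$ and $\Phi(\sigma_1)=\alpha_1\in K_0(R_A)$. In particular: (a) if $\chi_A\ne0$, there is an isomorphism $W(\widetilde T_A)\cong W(\widetilde R_A)$ with $\widetilde w_v\mapsto\widetilde r_v$; (b) if $\chi_A=0$, then $W(\widetilde T_A)$ is isomorphic via $\Phi$ to the hyperbolic extension of the elliptic Weyl group $W(\widetilde R_A)$, that is, to $W(R_A)\ltimes K_0(R_A)$ considered as a non-trivial (non-split) central extension of $W(\widetilde R_A)$ by $\mathbb Z$: there is a surjective homomorphism $\pi:W(R_A)\ltimes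 K_0(R_A)\to W(\widetilde R_A)$ whose kernel is central and isomorphic to $\mathbb Z$, which has no homomorphic section, and for which $\pi(\Phi(\widetilde w_v))=\widetilde r_v$ for all vertices $v$ of the octopus. -/

import Mathlib

/-- A quiver with finitely many vertices, arrows and relations, recorded through the sources and
targets of its arrows and of a minimal set of relations (a relation is a linear combination of
paths with common source and common target; `R` is empty for a quiver without relations). These
data determine the Euler form of the bounded derived category of finite-dimensional modules over
the bound quiver algebra when that algebra has global dimension at most two. -/
structure BoundQuiver (V E R : Type) where
  src : E → V
  tgt : E → V
  relSrc : R → V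
  relTgt : R → V

namespace BoundQuiver

variable {V E R : Type} [Fintype V] [DecidableEq V] [Fintype E] [Fintype R]

/-- The Euler form on the root lattice `⨁_v ℤ α_v = (V → ℤ)`, where `α_v` is the class of the
simple module at `v`: its value on `(α_v, α_w)` is `∑_p (-1)^p dim Ext^p(S_v, S_w)`, which equals
`δ_{vw} - #{arrows from v to w} + #{relations from v to w}`. -/
def eulerForm (Q : BoundQuiver V E R) (x y : V → ℤ) : ℤ :=
  ∑ v, x v * y v - ∑ f, x (Q.src f) * y (Q.tgt f) + ∑ p, x (Q.relSrc p) * y (Q.relTgt p)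

/-- The Cartan form `I(x, y) = χ(x, y) + χ(y, x)`. -/
def cartanForm (Q : BoundQuiver V E R) (x y : V → ℤ) : ℤ :=
  Q.eulerForm x y + Q.eulerForm y x

/-- The simple root `α_v`. -/
def simpleRoot (_Q : BoundQuiver V E R) (v : V) : V → ℤ := Pi.single v 1

/-- `g` is the reflection `r_α : λ ↦ λ - I(λ, α) α`. -/
def IsReflection (Q : BoundQuiver V E R) (α : V → ℤ) (g : (V → ℤ) ≃ₗ[ℤ] (V → ℤ)) : Prop :=
  ∀ x, g x = x - Q.cartanForm x α • α

/-- The group `W(B)` generated by the simple reflections. -/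
def simpleReflectionGroup (Q : BoundQuiver V E R) : Subgroup ((V → ℤ) ≃ₗ[ℤ] (V → ℤ)) :=
  Subgroup.closure {g | ∃ v, Q.IsReflection (Q.simpleRoot v) g}

/-- The set of real roots `Δ_re = W(B) B`. -/
def realRoots (Q : BoundQuiver V E R) : Set (V → ℤ) :=
  {α | ∃ g ∈ Q.simpleReflectionGroup, ∃ v, α = g (Q.simpleRoot v)}

/-- The Weyl group, generated by the reflections in all real roots. -/
def weylGroup (Q : BoundQuiver V E R) : Subgroup ((V → ℤ) ≃ₗ[ℤ] (V → ℤ)) :=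
  Subgroup.closure {g | ∃ α ∈ Q.realRoots, Q.IsReflection α g}

/-- The natural action of the Weyl group on the root lattice (written multiplicatively). -/
def weylAction (Q : BoundQuiver V E R) :
    Q.weylGroup →* MulAut (Multiplicative (V → ℤ)) :=
  (MulAutMultiplicative (V → ℤ)).symm.toMonoidHom.comp
    (DistribMulAction.toAddAut Q.weylGroup (V → ℤ))

/-- The semidirect product of the Weyl group with the root lattice. -/
abbrev WeylSemidirect (Q : BoundQuiver V E R) : Type :=
  Multiplicative (V → ℤ) ⋊[Q.weylAction] Q.weylGroup

end BoundQuiver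

/-- A tuple `A = (a_1, …, a_r)` with `r ≥ 3` and all `a_i ≥ 2`. -/
structure WeightTuple where
  r : ℕ
  three_le_r : 3 ≤ r
  a : Fin r → ℕ
  two_le_a : ∀ i, 2 ≤ a i

namespace WeightTuple

/-- `χ_A = 2 + ∑_i (1 / a_i - 1)`. -/
def chi (A : WeightTuple) : ℚ := 2 + ∑ i, (1 / (A.a i : ℚ) - 1)

/-- Vertices of the star quiver: the central vertex `1` and, for `j = 0, …, a_i - 2`, the vertex
`arm i j`, which stands for `(i, j + 1)`. -/
inductive StarVertex (A : WeightTuple) : Type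
  | center : StarVertex A
  | arm (i : Fin A.r) (j : Fin (A.a i - 1)) : StarVertex A
  deriving DecidableEq, Fintype

/-- Vertices of the octopus: those of the star quiver and one further vertex `1*`. -/
inductive OctopusVertex (A : WeightTuple) : Type
  | base (v : StarVertex A) : OctopusVertex A
  | starred : OctopusVertex A
  deriving DecidableEq, Fintype

/-- The vertex `(i, 1)`. -/
def firstVertex (A : WeightTuple) (i : Fin A.r) : StarVertex A :=
  .arm i ⟨0, by have := A.two_le_a i; omega⟩

/-- Arrows `f_{i,j}` of the star quiver (indexed by `i` and `j - 1`). -/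
abbrev StarArrow (A : WeightTuple) : Type := Σ i : Fin A.r, Fin (A.a i - 1)

/-- The source of `f_{i,1}` is `1`, that of `f_{i,j}` for `j ≥ 2` is `(i, j - 1)`. -/
def starSrc (A : WeightTuple) : StarArrow A → StarVertex A
  | ⟨_, ⟨0, _⟩⟩ => .center
  | ⟨i, ⟨j + 1, h⟩⟩ => .arm i ⟨j, Nat.lt_of_succ_lt h⟩

/-- The target of `f_{i,j}` is `(i, j)`. -/
def starTgt (A : WeightTuple) : StarArrow A → StarVertex A
  | ⟨i, j⟩ => .arm i j

/-- The star quiver of type `A`; it has no relations. -/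
def star (A : WeightTuple) : BoundQuiver (StarVertex A) (StarArrow A) Empty where
  src := A.starSrc
  tgt := A.starTgt
  relSrc := Empty.elim
  relTgt := Empty.elim

/-- The octopus of type `A`: the star quiver with `r` additional arrows
`f_{i,1*} : (i, 1) → 1*` and two relations `∑_i λ_i^{(1)} f_{i,1} f_{i,1*}` and
`∑_i λ_i^{(2)} f_{i,1} f_{i,1*}` from `1` to `1*`. -/
def octopus (A : WeightTuple) :
    BoundQuiver (OctopusVertex A) (StarArrow A ⊕ Fin A.r) (Fin 2) where
  src := Sum.elim (fun f => .base (A.starSrc f)) (fun i => .base (A.firstVertex i))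
  tgt := Sum.elim (fun f => .base (A.starTgt f)) (fun _ => .starred)
  relSrc := fun _ => .base .center
  relTgt := fun _ => .starred

/-- The free generator attached to a vertex. -/
def gen (A : WeightTuple) (v : OctopusVertex A) : FreeGroup (OctopusVertex A) := FreeGroup.of v

/-- The word `w̃_{(i,1)}`. -/
def firstGen (A : WeightTuple) (i : Fin A.r) : FreeGroup (OctopusVertex A) :=
  A.gen (.base (A.firstVertex i))

/-- The word `σ_1 = w̃_1 w̃_{1*}`. -/
def sigmaOne (A : WeightTuple) : FreeGroup (OctopusVertex A) :=
  A.gen (.base .center) * A.gen .starred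

/-- The word `σ_{(i,1)} = w̃_{(i,1)} σ_1 w̃_{(i,1)} σ_1⁻¹`. -/
def sigmaFirst (A : WeightTuple) (i : Fin A.r) : FreeGroup (OctopusVertex A) :=
  A.firstGen i * A.sigmaOne * A.firstGen i * A.sigmaOne⁻¹

/-- The entry `I(α̃_v, α̃_w)` of the Cartan matrix, that is, the edge of the octopus diagram
between `v` and `w`. -/
def octopusEdge (A : WeightTuple) (v w : OctopusVertex A) : ℤ :=
  A.octopus.cartanForm (A.octopus.simpleRoot v) (A.octopus.simpleRoot w)

/-- `x = y` for a pair `(x, y)` in this set are the generalized Coxeter relations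
W0, W1.0, W1.1, W2 and W3. -/
inductive CoxeterRel (A : WeightTuple) :
    FreeGroup (OctopusVertex A) → FreeGroup (OctopusVertex A) → Prop
  | w0 (v : OctopusVertex A) : CoxeterRel A (A.gen v ^ 2) 1
  | w10 (v w : OctopusVertex A) (h : A.octopusEdge v w = 0) :
      CoxeterRel A (A.gen v * A.gen w) (A.gen w * A.gen v)
  | w11 (v w : OctopusVertex A) (h : A.octopusEdge v w = -1) :
      CoxeterRel A (A.gen v * A.gen w * A.gen v) (A.gen w * A.gen v * A.gen w)
  | w2 (i : Fin A.r) :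
      CoxeterRel A (A.firstGen i * A.sigmaOne * A.firstGen i * A.sigmaOne)
        (A.sigmaOne * A.firstGen i * A.sigmaOne * A.firstGen i)
  | w3 (i j : Fin A.r) (h : i < j) :
      CoxeterRel A (A.firstGen i * A.sigmaFirst j) (A.sigmaFirst j * A.firstGen i)
  | w3' (i j : Fin A.r) (h : i < j) :
      CoxeterRel A (A.firstGen j * A.sigmaFirst i) (A.sigmaFirst i * A.firstGen j)

/-- The group `W(T̃_A)` presented by the generators `w̃_v` and the generalized Coxeter relations. -/
abbrev OctopusCoxeterGroup (A : WeightTuple) : Type :=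
  PresentedGroup {g | ∃ x y, CoxeterRel A x y ∧ g = x * y⁻¹}

/-- The generator `w̃_v` of `W(T̃_A)`. -/
def coxeterGen (A : WeightTuple) (v : OctopusVertex A) : OctopusCoxeterGroup A :=
  PresentedGroup.of v

end WeightTuple

/-- `π : H → G` is a non-trivial (that is, non-split) central extension of `G` by `ℤ`. -/
structure IsNontrivialCentralExtensionByInt {H G : Type} [Group H] [Group G] (π : H →* G) :
    Prop where
  surjective : Function.Surjective π
  central : π.ker ≤ Subgroup.center H
  ker_equiv : Nonempty (π.ker ≃* Multiplicative ℤ)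
  not_split : ¬ ∃ s : G →* H, π.comp s = MonoidHom.id G

/-! The homomorphism `toAffine` sends the base generators to simple reflections and `w̃_{1*}` to
`r_1` times the translation by `α_1`, so that `σ_1` becomes that translation. Its inverse is glued
from two maps on the factors of `W(R_A) ⋉ K_0(R_A)`.

On `W(R_A)`: the star is simply laced, and the geometric representation of its Coxeter group is
faithful (`IsSimplyLaced.geometricRep_injective`, from positivity of `w α_v` when `ℓ(w s_v) >
ℓ(w)`). Hence `W(R_A)` is presented by the Coxeter relations and maps to `W(T̃_A)`.

On `K_0(R_A)`: conjugating the translation by `α_1` successively by `r_{(i,1)}, …, r_{(i,j)}` gives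
the translation by `α_1 + α_{(i,1)} + … + α_{(i,j)}`. Quotients of consecutive conjugates of `σ_1`
are therefore the candidates `rootElement` for the simple translations. They commute
(`rootElement_commute`): W2 handles one arm, W3 two different arms. The reflection rule under
conjugation (`conj_rootElement`) glues the two maps.

For (a) and (b), `α̃_{1*} - α̃_1` lies in the radical of the octopus form, so the octopus lattice is
`K_0(R_A) ⊕ ℤ`. There `(x, w)` acts by `(λ, n) ↦ (w λ, n - I(w λ, x))`, and the generators act as
the simple reflections of the octopus. The kernel consists of translations by the radical of the
star form. A radical vector is linear along each arm and reaches `0` at index `a_i`, so the central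
equation becomes `x_1 χ_A = 0`: the radical is zero if `χ_A ≠ 0` and infinite cyclic if `χ_A = 0`.
In the latter case a splitting would give a retraction onto a central `ℤ`, impossible for a group
generated by involutions. -/

namespace BoundQuiver

variable {V E R : Type} [Fintype V] [Fintype E] [Fintype R]

/-! ### The Cartan form and the group of simple reflections. -/

theorem cartanForm_comm (Q : BoundQuiver V E R) (x y : V → ℤ) :
    Q.cartanForm x y = Q.cartanForm y x := add_comm _ _

theorem cartanForm_add_left (Q : BoundQuiver V E R) (x y z : V → ℤ) :
    Q.cartanForm (x + y) z = Q.cartanForm x z + Q.cartanForm y z := by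
  simp only [cartanForm, eulerForm, Pi.add_apply, add_mul, mul_add, Finset.sum_add_distrib]
  ring

theorem cartanForm_smul_left (Q : BoundQuiver V E R) (c : ℤ) (x z : V → ℤ) :
    Q.cartanForm (c • x) z = c * Q.cartanForm x z := by
  simp only [cartanForm, eulerForm, Pi.smul_apply, smul_eq_mul, mul_assoc, mul_left_comm _ c,
    ← Finset.mul_sum]
  ring

/-- The linear form `I(·, α)`. -/
def cartanFunctional (Q : BoundQuiver V E R) (α : V → ℤ) : (V → ℤ) →ₗ[ℤ] ℤ where
  toFun x := Q.cartanForm x α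
  map_add' x y := Q.cartanForm_add_left x y α
  map_smul' c x := Q.cartanForm_smul_left c x α

theorem cartanForm_sub_left (Q : BoundQuiver V E R) (x y z : V → ℤ) :
    Q.cartanForm (x - y) z = Q.cartanForm x z - Q.cartanForm y z :=
  map_sub (Q.cartanFunctional z) x y

theorem cartanForm_zero_left (Q : BoundQuiver V E R) (z : V → ℤ) : Q.cartanForm 0 z = 0 :=
  map_zero (Q.cartanFunctional z)

theorem cartanForm_add_right (Q : BoundQuiver V E R) (x y z : V → ℤ) :
    Q.cartanForm x (y + z) = Q.cartanForm x y + Q.cartanForm x z := by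
  rw [cartanForm_comm, cartanForm_add_left, Q.cartanForm_comm y, Q.cartanForm_comm z]

theorem cartanForm_smul_right (Q : BoundQuiver V E R) (c : ℤ) (x z : V → ℤ) :
    Q.cartanForm x (c • z) = c * Q.cartanForm x z := by
  rw [cartanForm_comm, cartanForm_smul_left, cartanForm_comm]

theorem cartanForm_sub_right (Q : BoundQuiver V E R) (x y z : V → ℤ) :
    Q.cartanForm x (y - z) = Q.cartanForm x y - Q.cartanForm x z := by
  rw [cartanForm_comm, cartanForm_sub_left, Q.cartanForm_comm y, Q.cartanForm_comm z]

theorem cartanForm_zero_right (Q : BoundQuiver V E R) (x : V → ℤ) : Q.cartanForm x 0 = 0 := by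
  rw [cartanForm_comm, cartanForm_zero_left]

theorem IsReflection.unique {Q : BoundQuiver V E R} {α : V → ℤ}
    {g h : (V → ℤ) ≃ₗ[ℤ] (V → ℤ)} (hg : Q.IsReflection α g) (hh : Q.IsReflection α h) : g = h :=
  LinearEquiv.ext fun x => (hg x).trans (hh x).symm

variable [DecidableEq V]

/-- All simple roots have norm two, so that the simple reflections exist. -/
def IsNormalized (Q : BoundQuiver V E R) : Prop :=
  ∀ v, Q.cartanForm (Q.simpleRoot v) (Q.simpleRoot v) = 2

variable {Q : BoundQuiver V E R}

/-- The reflection in a simple root. -/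
def IsNormalized.simpleReflection (hQ : Q.IsNormalized) (v : V) : (V → ℤ) ≃ₗ[ℤ] (V → ℤ) :=
  Module.reflection (f := Q.cartanFunctional (Q.simpleRoot v)) (hQ v)

theorem IsNormalized.isReflection (hQ : Q.IsNormalized) (v : V) :
    Q.IsReflection (Q.simpleRoot v) (hQ.simpleReflection v) := fun x =>
  Module.reflection_apply x _

theorem IsNormalized.simpleReflection_apply (hQ : Q.IsNormalized) (v : V) (x : V → ℤ) :
    hQ.simpleReflection v x = x - Q.cartanForm x (Q.simpleRoot v) • Q.simpleRoot v :=
  hQ.isReflection v x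

theorem IsNormalized.cartanForm_simpleReflection (hQ : Q.IsNormalized) (v : V) (x y : V → ℤ) :
    Q.cartanForm (hQ.simpleReflection v x) (hQ.simpleReflection v y) = Q.cartanForm x y := by
  simp only [hQ.simpleReflection_apply, cartanForm_sub_left, cartanForm_sub_right,
    cartanForm_smul_left, cartanForm_smul_right, hQ v, Q.cartanForm_comm (Q.simpleRoot v) y]
  ring

theorem IsNormalized.simpleReflectionGroup_eq (hQ : Q.IsNormalized) :
    Q.simpleReflectionGroup = Subgroup.closure (Set.range hQ.simpleReflection) := by
  unfold simpleReflectionGroup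
  congr 1
  ext g
  constructor
  · rintro ⟨v, hv⟩
    exact ⟨v, (hQ.isReflection v).unique hv⟩
  · rintro ⟨v, rfl⟩
    exact ⟨v, hQ.isReflection v⟩

theorem IsNormalized.cartanForm_map_of_mem (hQ : Q.IsNormalized) {g : (V → ℤ) ≃ₗ[ℤ] (V → ℤ)}
    (hg : g ∈ Q.simpleReflectionGroup) :
    ∀ x y, Q.cartanForm (g x) (g y) = Q.cartanForm x y := by
  rw [hQ.simpleReflectionGroup_eq] at hg
  induction hg using Subgroup.closure_induction with
  | mem g hg =>
    obtain ⟨v, rfl⟩ := hg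
    exact hQ.cartanForm_simpleReflection v
  | one => exact fun _ _ => rfl
  | mul g h _ _ hg hh =>
    intro x y
    rw [LinearEquiv.mul_apply, LinearEquiv.mul_apply, hg, hh]
  | inv g _ hg =>
    intro x y
    rw [← hg]
    exact congr_arg₂ _ (g.apply_symm_apply x) (g.apply_symm_apply y)

/-- The Weyl group is generated by the simple reflections. -/
theorem IsNormalized.weylGroup_eq (hQ : Q.IsNormalized) :
    Q.weylGroup = Subgroup.closure (Set.range hQ.simpleReflection) := by
  rw [← hQ.simpleReflectionGroup_eq]
  apply le_antisymm
  · refine (Subgroup.closure_le _).2 ?_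
    rintro g ⟨_, ⟨h, hh, v, rfl⟩, hg⟩
    -- Since `h` preserves the form, conjugating `r_{α_v}` by `h` gives the reflection in `h α_v`.
    have : g = h * hQ.simpleReflection v * h⁻¹ := by
      ext1 x
      rw [hg x, LinearEquiv.mul_apply, LinearEquiv.mul_apply, hQ.simpleReflection_apply, map_sub,
        map_smul, ← hQ.cartanForm_map_of_mem hh (h⁻¹ x)]
      have hx : h (h⁻¹ x) = x := h.apply_symm_apply x
      rw [hx]
    rw [this]
    refine mul_mem (mul_mem hh ?_) (inv_mem hh)
    exact Subgroup.subset_closure ⟨v, hQ.isReflection v⟩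
  · refine (Subgroup.closure_le _).2 ?_
    rintro g ⟨v, hv⟩
    exact Subgroup.subset_closure ⟨_, ⟨1, one_mem _, v, rfl⟩, hv⟩

theorem IsNormalized.cartanForm_map (hQ : Q.IsNormalized) (g : Q.weylGroup) (x y : V → ℤ) :
    Q.cartanForm (g.1 x) (g.1 y) = Q.cartanForm x y := by
  exact hQ.cartanForm_map_of_mem
    ((hQ.weylGroup_eq.trans hQ.simpleReflectionGroup_eq.symm).le g.2) x y

/-- The simple reflection at `v` as an element of the Weyl group. -/
def IsNormalized.weylSimple (hQ : Q.IsNormalized) (v : V) : Q.weylGroup :=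
  ⟨hQ.simpleReflection v, by
    rw [hQ.weylGroup_eq]; exact Subgroup.subset_closure (Set.mem_range_self v)⟩

theorem IsNormalized.coe_weylSimple (hQ : Q.IsNormalized) (v : V) :
    (hQ.weylSimple v : (V → ℤ) ≃ₗ[ℤ] (V → ℤ)) = hQ.simpleReflection v := rfl

theorem IsNormalized.closure_range_weylSimple (hQ : Q.IsNormalized) :
    Subgroup.closure (Set.range hQ.weylSimple) = ⊤ := by
  apply Subgroup.map_injective (Subgroup.subtype_injective Q.weylGroup)
  rw [MonoidHom.map_closure, ← Set.range_comp, ← MonoidHom.range_eq_map, Subgroup.range_subtype]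
  exact hQ.weylGroup_eq.symm

/-! ### Simply laced Weyl groups are Coxeter groups. -/

/-- A simply laced quiver: distinct simple roots pair to `0` or `-1`. -/
structure IsSimplyLaced (Q : BoundQuiver V E R) : Prop where
  normalized : Q.IsNormalized
  edge : ∀ v w, v ≠ w → Q.cartanForm (Q.simpleRoot v) (Q.simpleRoot w) = 0 ∨
    Q.cartanForm (Q.simpleRoot v) (Q.simpleRoot w) = -1

/-- The Coxeter matrix of a simply laced quiver. -/
def coxeterMatrix (Q : BoundQuiver V E R) : CoxeterMatrix V where
  M := fun v w => if v = w then 1 else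
    if Q.cartanForm (Q.simpleRoot v) (Q.simpleRoot w) = 0 then 2 else 3
  isSymm := Matrix.IsSymm.ext fun v w => by
    simp only [eq_comm (a := w), Q.cartanForm_comm (Q.simpleRoot w)]
  diagonal := by simp
  off_diagonal := by
    intro v w h
    simp only [h, if_false]
    split_ifs <;> decide

theorem IsSimplyLaced.isLiftable (hQ : Q.IsSimplyLaced) {G : Type*} [Group G] {f : V → G}
    (hsq : ∀ v, f v * f v = 1)
    (hcomm : ∀ v w, Q.cartanForm (Q.simpleRoot v) (Q.simpleRoot w) = 0 → f v * f w = f w * f v)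
    (hbraid : ∀ v w, Q.cartanForm (Q.simpleRoot v) (Q.simpleRoot w) = -1 →
      f v * f w * f v = f w * f v * f w) :
    Q.coxeterMatrix.IsLiftable f := by
  intro v w
  by_cases h : v = w
  · subst h; simp [coxeterMatrix, hsq]
  rcases hQ.edge v w h with h0 | h1
  · have : Q.coxeterMatrix.M v w = 2 := by simp [coxeterMatrix, h, h0]
    rw [this, sq]
    calc f v * f w * (f v * f w) = f v * f w * (f w * f v) := by rw [hcomm v w h0]
      _ = f v * (f w * f w) * f v := by group
      _ = 1 := by rw [hsq, mul_one, hsq]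
  · have : Q.coxeterMatrix.M v w = 3 := by simp [coxeterMatrix, h, h1]
    rw [this, pow_succ, sq]
    calc f v * f w * (f v * f w) * (f v * f w) = (f v * f w * f v) * (f w * f v * f w) := by group
      _ = (f w * f v * f w) * (f w * f v * f w) := by rw [hbraid v w h1]
      _ = f w * f v * (f w * f w) * f v * f w := by group
      _ = f w * (f v * f v) * f w := by rw [hsq w]; group
      _ = 1 := by rw [hsq, mul_one, hsq]

theorem IsNormalized.simpleReflection_mul_self (hQ : Q.IsNormalized) (v : V) :
    hQ.simpleReflection v * hQ.simpleReflection v = 1 := by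
  ext1 x
  exact Module.involutive_reflection (hQ v) x

theorem IsNormalized.simpleReflection_comm (hQ : Q.IsNormalized) {v w : V}
    (h : Q.cartanForm (Q.simpleRoot v) (Q.simpleRoot w) = 0) :
    hQ.simpleReflection v * hQ.simpleReflection w =
      hQ.simpleReflection w * hQ.simpleReflection v := by
  have h' := h
  rw [cartanForm_comm] at h'
  ext1 x
  simp only [LinearEquiv.mul_apply, hQ.simpleReflection_apply, cartanForm_sub_left,
    cartanForm_smul_left, h, h']
  module

theorem IsNormalized.simpleReflection_braid (hQ : Q.IsNormalized) {v w : V}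
    (h : Q.cartanForm (Q.simpleRoot v) (Q.simpleRoot w) = -1) :
    hQ.simpleReflection v * hQ.simpleReflection w * hQ.simpleReflection v =
      hQ.simpleReflection w * hQ.simpleReflection v * hQ.simpleReflection w := by
  have h' := h
  rw [cartanForm_comm] at h'
  ext1 x
  simp only [LinearEquiv.mul_apply, hQ.simpleReflection_apply, cartanForm_sub_left,
    cartanForm_smul_left, h, h', hQ v, hQ w]
  module

/-- The geometric representation of the Coxeter group of a simply laced quiver. -/
def IsSimplyLaced.geometricRep (hQ : Q.IsSimplyLaced) :
    Q.coxeterMatrix.Group →* ((V → ℤ) ≃ₗ[ℤ] (V → ℤ)) :=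
  Q.coxeterMatrix.toCoxeterSystem.lift ⟨hQ.normalized.simpleReflection,
    hQ.isLiftable hQ.normalized.simpleReflection_mul_self
      (fun _ _ => hQ.normalized.simpleReflection_comm)
      (fun _ _ => hQ.normalized.simpleReflection_braid)⟩

theorem IsSimplyLaced.geometricRep_simple (hQ : Q.IsSimplyLaced) (v : V) :
    hQ.geometricRep (Q.coxeterMatrix.toCoxeterSystem.simple v) =
      hQ.normalized.simpleReflection v :=
  CoxeterSystem.lift_apply_simple _ _ v

/-- If `ℓ(w s_v) > ℓ(w)`, then `w` sends `α_v` to a positive root. -/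
theorem IsSimplyLaced.geometricRep_nonneg (hQ : Q.IsSimplyLaced) (n : ℕ)
    (w : Q.coxeterMatrix.Group) (hn : Q.coxeterMatrix.toCoxeterSystem.length w = n) (v : V)
    (h : ¬ Q.coxeterMatrix.toCoxeterSystem.IsRightDescent w v) :
    0 ≤ hQ.geometricRep w (Q.simpleRoot v) := by
  induction n using Nat.strong_induction_on generalizing w v with
  | _ n ih =>
  set cs := Q.coxeterMatrix.toCoxeterSystem with hcs
  by_cases hw : w = 1
  · subst hw
    rw [map_one]
    exact Pi.single_nonneg.2 zero_le_one
  -- A right descent `t` gives a shorter `u = w s_t`. The value `w α_v` is then computed in the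
  -- dihedral group generated by `s_t` and `s_v`, of order 4 or 6, and expressed through shorter
  -- elements.
  obtain ⟨t, ht⟩ := cs.exists_rightDescent_of_ne_one hw
  have htv : t ≠ v := fun e => h (e ▸ ht)
  set u := w * cs.simple t with hu
  have hwu : w = u * cs.simple t := by rw [hu, cs.simple_mul_simple_cancel_right]
  have hlu : cs.length u + 1 = n := by rw [← hn]; exact cs.isRightDescent_iff.1 ht
  have hut : ¬ cs.IsRightDescent u t := (cs.isRightDescent_iff_not_isRightDescent_mul).1 ht
  have hlwv : cs.length (w * cs.simple v) = n + 1 := by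
    rw [← hn]; exact cs.not_isRightDescent_iff.1 h
  have hs : ∀ i : V, hQ.geometricRep (cs.simple i) = hQ.normalized.simpleReflection i :=
    hQ.geometricRep_simple
  rcases hQ.edge t v htv with h0 | h1
  · have h0' := h0
    rw [cartanForm_comm] at h0'
    have hcomm : cs.simple t * cs.simple v = cs.simple v * cs.simple t := by
      have hM : Q.coxeterMatrix t v = 2 := by
        change (if t = v then 1 else _) = 2
        rw [if_neg htv, if_pos h0]
      have := cs.simple_mul_simple_pow t v
      rw [hM, sq] at this
      have := mul_eq_one_iff_eq_inv.1 this
      rwa [mul_inv_rev, cs.inv_simple, cs.inv_simple] at this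
    have hval : hQ.geometricRep w (Q.simpleRoot v) = hQ.geometricRep u (Q.simpleRoot v) := by
      rw [hwu, map_mul, LinearEquiv.mul_apply, hs, hQ.normalized.simpleReflection_apply, h0',
        zero_smul, sub_zero]
    rw [hval]
    -- A descent of `u` at `v` would give `ℓ(w s_v) ≤ ℓ(u s_v) + 1 = n - 1`, against `ℓ(w s_v) = n +
    -- 1`.
    refine ih _ (by omega) u rfl v fun hd => ?_
    have h2 : w * cs.simple v = u * cs.simple v * cs.simple t := by
      rw [hwu, mul_assoc, hcomm, ← mul_assoc]
    have h3 := cs.length_mul_le (u * cs.simple v) (cs.simple t)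
    rw [← h2, cs.length_simple] at h3
    have := cs.isRightDescent_iff.1 hd
    omega
  · have h1' := h1
    rw [cartanForm_comm] at h1'
    have hbraid : cs.simple v * cs.simple t * cs.simple v =
        cs.simple t * cs.simple v * cs.simple t := by
      have hM : Q.coxeterMatrix t v = 3 := by
        change (if t = v then 1 else if _ then 2 else 3) = 3
        rw [if_neg htv, if_neg (by rw [h1]; decide)]
      have := cs.simple_mul_simple_pow t v
      rw [hM, pow_succ, sq] at this
      have h4 : (cs.simple t * cs.simple v * cs.simple t) *
          (cs.simple v * cs.simple t * cs.simple v) = 1 := by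
        rw [← this]; group
      have := mul_eq_one_iff_inv_eq.1 h4
      rw [mul_inv_rev, mul_inv_rev, cs.inv_simple, cs.inv_simple, ← mul_assoc] at this
      exact this.symm
    have hval : hQ.geometricRep w (Q.simpleRoot v) =
        hQ.geometricRep u (Q.simpleRoot v) + hQ.geometricRep u (Q.simpleRoot t) := by
      rw [hwu, map_mul, LinearEquiv.mul_apply, hs, hQ.normalized.simpleReflection_apply, h1',
        neg_smul, one_smul, sub_neg_eq_add, map_add]
    -- If `v` is a descent of `u`, then `u α_v` need not be nonnegative; stripping `s_v` as well
    -- leaves the single term `u' α_t`, because `s_v s_t α_v = α_t`.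
    by_cases hd : cs.IsRightDescent u v
    · set u' := u * cs.simple v with hu'
      have huu : u = u' * cs.simple v := by rw [hu', cs.simple_mul_simple_cancel_right]
      have hlu' := cs.isRightDescent_iff.1 hd
      rw [← hu'] at hlu'
      have hval' : hQ.geometricRep w (Q.simpleRoot v) = hQ.geometricRep u' (Q.simpleRoot t) := by
        rw [hval, huu, map_mul, LinearEquiv.mul_apply, LinearEquiv.mul_apply, hs,
          hQ.normalized.simpleReflection_apply, hQ.normalized.simpleReflection_apply, h1,
          hQ.normalized v, ← map_add]
        congr 1
        module
      rw [hval']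
      refine ih _ (by omega) u' rfl t fun hd' => ?_
      have h2 : w * cs.simple v = u' * cs.simple t * (cs.simple v * cs.simple t) := by
        rw [hwu, huu]
        calc u' * cs.simple v * cs.simple t * cs.simple v
            = u' * (cs.simple v * cs.simple t * cs.simple v) := by group
          _ = _ := by rw [hbraid]; group
      have h3 := cs.length_mul_le (u' * cs.simple t) (cs.simple v * cs.simple t)
      have h5 := cs.length_mul_le (cs.simple v) (cs.simple t)
      rw [cs.length_simple, cs.length_simple] at h5
      rw [← h2] at h3
      have := cs.isRightDescent_iff.1 hd'
      omega
    · rw [hval]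
      exact add_nonneg (ih _ (by omega) u rfl v hd) (ih _ (by omega) u rfl t hut)

/-- The geometric representation of a simply laced Coxeter group is faithful. -/
theorem IsSimplyLaced.geometricRep_injective (hQ : Q.IsSimplyLaced) :
    Function.Injective hQ.geometricRep := by
  rw [injective_iff_map_eq_one]
  intro w hw
  by_contra hne
  set cs := Q.coxeterMatrix.toCoxeterSystem with hcs
  obtain ⟨t, ht⟩ := cs.exists_rightDescent_of_ne_one hne
  -- Positivity makes `w s_t α_t` nonnegative, but it equals `-α_t` when `w` acts trivially.
  have h1 := hQ.geometricRep_nonneg _ (w * cs.simple t) rfl t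
    ((cs.isRightDescent_iff_not_isRightDescent_mul).1 ht)
  rw [map_mul, hw, one_mul, hQ.geometricRep_simple, hQ.normalized.simpleReflection_apply,
    hQ.normalized t] at h1
  have := h1 t
  simp [simpleRoot] at this

/-- The Weyl group of a simply laced quiver is the Coxeter group of its Coxeter matrix. -/
noncomputable def IsSimplyLaced.weylEquiv (hQ : Q.IsSimplyLaced) :
    Q.coxeterMatrix.Group ≃* Q.weylGroup :=
  (MonoidHom.ofInjective hQ.geometricRep_injective).trans (MulEquiv.subgroupCongr (by
    rw [hQ.normalized.weylGroup_eq, MonoidHom.range_eq_map,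
      ← Q.coxeterMatrix.toCoxeterSystem.subgroup_closure_range_simple, MonoidHom.map_closure,
      ← Set.range_comp]
    exact congr_arg (fun F => Subgroup.closure (Set.range F)) (funext hQ.geometricRep_simple)))

theorem IsSimplyLaced.weylEquiv_simple (hQ : Q.IsSimplyLaced) (v : V) :
    hQ.weylEquiv (Q.coxeterMatrix.toCoxeterSystem.simple v) = hQ.normalized.weylSimple v :=
  Subtype.ext (hQ.geometricRep_simple v)

/-- The Coxeter relations define a homomorphism on the Weyl group of a simply laced quiver. -/
theorem IsSimplyLaced.exists_weylLift (hQ : Q.IsSimplyLaced) {G : Type*} [Group G] {f : V → G}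
    (hsq : ∀ v, f v * f v = 1)
    (hcomm : ∀ v w, Q.cartanForm (Q.simpleRoot v) (Q.simpleRoot w) = 0 → f v * f w = f w * f v)
    (hbraid : ∀ v w, Q.cartanForm (Q.simpleRoot v) (Q.simpleRoot w) = -1 →
      f v * f w * f v = f w * f v * f w) :
    ∃ F : Q.weylGroup →* G, ∀ v, F (hQ.normalized.weylSimple v) = f v := by
  refine ⟨(Q.coxeterMatrix.toCoxeterSystem.lift ⟨f, hQ.isLiftable hsq hcomm hbraid⟩).comp
    hQ.weylEquiv.symm.toMonoidHom, fun v => ?_⟩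
  rw [MonoidHom.comp_apply, ← hQ.weylEquiv_simple]
  exact (congr_arg _ (hQ.weylEquiv.symm_apply_apply _)).trans
    (CoxeterSystem.lift_apply_simple _ _ v)

end BoundQuiver

/-! ### Cartan forms of the star and of the octopus. -/

namespace WeightTuple

open BoundQuiver

variable {A : WeightTuple}

theorem sum_octopusVertex (g : A.OctopusVertex → ℤ) :
    ∑ v, g v = ∑ v, g (.base v) + g .starred := by
  let e : A.StarVertex ⊕ Unit ≃ A.OctopusVertex :=
    { toFun := Sum.elim .base (fun _ => .starred)
      invFun := fun v => match v with
        | .base v => .inl v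
        | .starred => .inr ()
      left_inv := by rintro (_ | _) <;> rfl
      right_inv := by rintro (_ | _) <;> rfl }
  rw [← e.sum_comp, Fintype.sum_sum_type]
  simp [e]

theorem sum_mul_single {V : Type} [Fintype V] [DecidableEq V] (x : V → ℤ) (v : V) :
    ∑ u, x u * (Pi.single v 1 : V → ℤ) u = x v := by
  simp [Pi.single_apply]

theorem sum_single_mul {V : Type} [Fintype V] [DecidableEq V] (x : V → ℤ) (v : V) :
    ∑ u, (Pi.single v 1 : V → ℤ) u * x u = x v := by
  simp [Pi.single_apply]

/-- The coordinates of a vector along the `i`-th arm, starting with the center and continued by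
zero beyond the end of the arm. -/
def armCoord (x : A.StarVertex → ℤ) (i : Fin A.r) : ℕ → ℤ
  | 0 => x .center
  | j + 1 => if h : j < A.a i - 1 then x (.arm i ⟨j, h⟩) else 0

theorem armCoord_succ_of_lt (x : A.StarVertex → ℤ) (i : Fin A.r) {j : ℕ} (h : j < A.a i - 1) :
    armCoord x i (j + 1) = x (.arm i ⟨j, h⟩) := dif_pos h

theorem armCoord_succ (x : A.StarVertex → ℤ) (i : Fin A.r) (j : Fin (A.a i - 1)) :
    armCoord x i (j + 1) = x (.arm i j) := armCoord_succ_of_lt x i j.2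

theorem armCoord_succ_of_le (x : A.StarVertex → ℤ) (i : Fin A.r) {j : ℕ} (h : A.a i - 1 ≤ j) :
    armCoord x i (j + 1) = 0 := dif_neg (not_lt.2 h)

theorem armCoord_one (x : A.StarVertex → ℤ) (i : Fin A.r) :
    armCoord x i 1 = x (A.firstVertex i) :=
  armCoord_succ_of_lt x i (by have := A.two_le_a i; omega)

theorem starSrc_coord (x : A.StarVertex → ℤ) (i : Fin A.r) (j : Fin (A.a i - 1)) :
    x (A.starSrc ⟨i, j⟩) = armCoord x i j := by
  obtain ⟨j, hj⟩ := j
  cases j with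
  | zero => rfl
  | succ j => exact (armCoord_succ_of_lt x i _).symm

theorem star_cartanForm_center (x : A.StarVertex → ℤ) :
    A.star.cartanForm x (A.star.simpleRoot .center) =
      2 * x .center - ∑ i, x (A.firstVertex i) := by
  have h1 : ∀ f : A.StarArrow, (Pi.single .center 1 : A.StarVertex → ℤ) (A.starTgt f) = 0 := by
    rintro ⟨i, j⟩
    simp [starTgt]
  have h2 : ∀ i, ∑ j, (Pi.single .center 1 : A.StarVertex → ℤ) (A.starSrc ⟨i, j⟩) *
      x (.arm i j) = x (A.firstVertex i) := by
    intro i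
    rw [Fintype.sum_eq_single (⟨0, by have := A.two_le_a i; omega⟩ : Fin (A.a i - 1))]
    · simp [starSrc, firstVertex]
    · rintro ⟨j, hj⟩ h
      cases j with
      | zero => exact absurd rfl h
      | succ j => simp [starSrc]
  simp only [cartanForm, eulerForm, simpleRoot, star, Fintype.sum_sigma, Finset.univ_eq_empty,
    Finset.sum_empty, h1, sum_mul_single, sum_single_mul, mul_zero]
  simp only [starTgt, h2]
  simp
  ring

/-- The form is a negative second difference along the arm. The conventions of `armCoord` (center at
index `0`, zero past the end) spare separate formulas for the two ends. -/
theorem star_cartanForm_arm (x : A.StarVertex → ℤ) (i : Fin A.r) (j : Fin (A.a i - 1)) :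
    A.star.cartanForm x (A.star.simpleRoot (.arm i j)) =
      2 * armCoord x i (j + 1) - armCoord x i j - armCoord x i (j + 2) := by
  have h1 : ∑ i', ∑ j', x (A.starSrc ⟨i', j'⟩) *
      (Pi.single (.arm i j) 1 : A.StarVertex → ℤ) (.arm i' j') = armCoord x i j := by
    rw [Fintype.sum_eq_single i, Fintype.sum_eq_single j, starSrc_coord x]
    · simp
    · intro j' h
      simp [h]
    · intro i' h
      simp [h]
  have h2 : ∑ i', ∑ j', (Pi.single (.arm i j) 1 : A.StarVertex → ℤ) (A.starSrc ⟨i', j'⟩) *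
      x (.arm i' j') = armCoord x i (j + 2) := by
    -- The only arrow starting at `arm i j` is the next one on the same arm; at the tip there is
    -- none.
    have hz : ∀ i' (j' : Fin (A.a i' - 1)), ¬ (i' = i ∧ (j' : ℕ) = j + 1) →
        (Pi.single (.arm i j) 1 : A.StarVertex → ℤ) (A.starSrc ⟨i', j'⟩) = 0 := by
      rintro i' ⟨j', hj'⟩ h
      cases j' with
      | zero => simp [starSrc]
      | succ j' =>
        rw [Pi.single_apply, if_neg]
        rintro e
        simp only [starSrc, StarVertex.arm.injEq] at e
        obtain ⟨rfl, e⟩ := e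
        have := congr_arg Fin.val (eq_of_heq e)
        exact h ⟨rfl, by simp only at this ⊢; omega⟩
    rw [Fintype.sum_eq_single i fun i' h => Finset.sum_eq_zero fun j' _ => by
      rw [hz i' j' fun h' => h h'.1, zero_mul]]
    by_cases h : (j : ℕ) + 1 < A.a i - 1
    · rw [Fintype.sum_eq_single ⟨j + 1, h⟩, armCoord_succ_of_lt x i h]
      · simp [starSrc]
      · intro j' hj'
        rw [hz i j' fun h' => hj' (Fin.ext h'.2), zero_mul]
    · rw [armCoord_succ_of_le x i (not_lt.1 h)]
      refine Finset.sum_eq_zero fun j' _ => ?_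
      rw [hz i j' fun h' => h (h'.2 ▸ j'.2), zero_mul]
  simp only [cartanForm, eulerForm, simpleRoot, star, Fintype.sum_sigma, Finset.univ_eq_empty,
    Finset.sum_empty, starTgt, h1, h2, armCoord_succ, sum_mul_single, sum_single_mul]
  ring

theorem armCoord_simpleRoot_center (i : Fin A.r) (k : ℕ) :
    armCoord (A.star.simpleRoot .center) i k = if k = 0 then 1 else 0 := by
  cases k with
  | zero => simp [armCoord, simpleRoot]
  | succ k => simp [armCoord, simpleRoot]

theorem armCoord_simpleRoot_arm (i i' : Fin A.r) (j : Fin (A.a i - 1)) (k : ℕ) :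
    armCoord (A.star.simpleRoot (.arm i j)) i' k = if i = i' ∧ k = j + 1 then 1 else 0 := by
  cases k with
  | zero => simp [armCoord, simpleRoot]
  | succ k =>
    by_cases hi : i = i'
    · subst hi
      by_cases hk : k < A.a i - 1
      · simp [armCoord, simpleRoot, hk, Pi.single_apply, Fin.ext_iff]
      · have : k ≠ j := fun e => hk (e ▸ j.2)
        simp [armCoord, hk, this]
    · simp only [armCoord, simpleRoot, hi, false_and, if_false]
      split_ifs
      · rw [Pi.single_apply, if_neg]
        rintro e
        simp only [StarVertex.arm.injEq] at e
        exact hi e.1.symm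
      · rfl

theorem star_edge_center_center :
    A.star.cartanForm (A.star.simpleRoot .center) (A.star.simpleRoot .center) = 2 := by
  rw [star_cartanForm_center]
  simp [simpleRoot, firstVertex]

theorem star_edge_center_arm (i : Fin A.r) (j : Fin (A.a i - 1)) :
    A.star.cartanForm (A.star.simpleRoot .center) (A.star.simpleRoot (.arm i j)) =
      if (j : ℕ) = 0 then -1 else 0 := by
  rw [star_cartanForm_arm]
  simp only [armCoord_simpleRoot_center]
  split_ifs <;> simp_all

theorem star_edge_arm_center (i : Fin A.r) (j : Fin (A.a i - 1)) :
    A.star.cartanForm (A.star.simpleRoot (.arm i j)) (A.star.simpleRoot .center) =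
      if (j : ℕ) = 0 then -1 else 0 := by
  rw [cartanForm_comm, star_edge_center_arm]

theorem star_edge_arm_arm_of_ne {i i' : Fin A.r} (h : i ≠ i') (j : Fin (A.a i - 1))
    (j' : Fin (A.a i' - 1)) :
    A.star.cartanForm (A.star.simpleRoot (.arm i j)) (A.star.simpleRoot (.arm i' j')) = 0 := by
  rw [star_cartanForm_arm]
  simp [armCoord_simpleRoot_arm, h]

theorem star_edge_arm_arm (i : Fin A.r) (j k : Fin (A.a i - 1)) :
    A.star.cartanForm (A.star.simpleRoot (.arm i j)) (A.star.simpleRoot (.arm i k)) =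
      if j = k then 2 else if (j : ℕ) = k + 1 ∨ (k : ℕ) = j + 1 then -1 else 0 := by
  rw [star_cartanForm_arm]
  simp only [armCoord_simpleRoot_arm, true_and, Fin.ext_iff]
  split_ifs <;> omega

theorem star_isSimplyLaced (A : WeightTuple) : A.star.IsSimplyLaced where
  normalized := by
    rintro (_ | ⟨i, j⟩)
    · exact star_edge_center_center
    · rw [star_edge_arm_arm, if_pos rfl]
  edge := by
    rintro (_ | ⟨i, j⟩) (_ | ⟨i', j'⟩) h
    · exact absurd rfl h
    · rw [star_edge_center_arm]; split_ifs <;> simp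
    · rw [star_edge_arm_center]; split_ifs <;> simp
    · by_cases hi : i = i'
      · subst hi
        rw [star_edge_arm_arm, if_neg (by rintro rfl; exact h rfl)]
        split_ifs <;> simp
      · exact Or.inl (star_edge_arm_arm_of_ne hi j j')

/-- The projection of the octopus lattice onto the star lattice along `α̃_{1*} - α̃_1`. -/
def collapse (A : WeightTuple) : (A.OctopusVertex → ℤ) →ₗ[ℤ] (A.StarVertex → ℤ) where
  toFun x v := x (.base v) + x .starred * A.star.simpleRoot .center v
  map_add' x y := by
    ext v
    simp only [Pi.add_apply]
    ring
  map_smul' c x := by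
    ext v
    simp only [Pi.smul_apply, smul_eq_mul, RingHom.id_apply]
    ring

theorem collapse_eq (x : A.OctopusVertex → ℤ) :
    A.collapse x = (fun v => x (.base v)) + x .starred • A.star.simpleRoot .center := rfl

/-- The arrows `(i,1) → 1*` make `α̃_{1*}` pair with the arms as `α̃_1` does, and the two relations
give `I(α̃_1, α̃_{1*}) = 2`. So `α̃_{1*} - α̃_1` is in the radical and the form factors through
`collapse`. -/
theorem octopus_cartanForm (x y : A.OctopusVertex → ℤ) :
    A.octopus.cartanForm x y = A.star.cartanForm (A.collapse x) (A.collapse y) := by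
  have h : A.octopus.cartanForm x y =
      A.star.cartanForm (fun v => x (.base v)) (fun v => y (.base v)) +
        2 * (x .starred * y .starred) -
        ∑ i, x (.base (A.firstVertex i)) * y .starred -
        ∑ i, y (.base (A.firstVertex i)) * x .starred +
        2 * (x (.base .center) * y .starred) + 2 * (y (.base .center) * x .starred) := by
    simp only [cartanForm, eulerForm, octopus, star, sum_octopusVertex, Fintype.sum_sum_type,
      Sum.elim_inl, Sum.elim_inr, Finset.univ_eq_empty, Finset.sum_empty, Fin.sum_univ_two]
    ring
  rw [h, collapse_eq, collapse_eq]
  simp only [cartanForm_add_left, cartanForm_add_right, cartanForm_smul_left,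
    cartanForm_smul_right, star_cartanForm_center,
    A.star.cartanForm_comm (A.star.simpleRoot .center), ← Finset.sum_mul]
  have h0 : A.star.simpleRoot .center .center = 1 := Pi.single_eq_same _ _
  have h1 : ∀ i, A.star.simpleRoot .center (A.firstVertex i) = 0 := fun i => by
    simp [simpleRoot, firstVertex]
  simp only [h0, h1, Finset.sum_const_zero]
  ring

theorem collapse_simpleRoot_base (v : A.StarVertex) :
    A.collapse (A.octopus.simpleRoot (.base v)) = A.star.simpleRoot v := by
  ext w
  simp [collapse, simpleRoot, Pi.single_apply]

theorem collapse_simpleRoot_starred :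
    A.collapse (A.octopus.simpleRoot .starred) = A.star.simpleRoot .center := by
  ext w
  simp [collapse, simpleRoot]

theorem octopusEdge_base_base (v w : A.StarVertex) :
    A.octopusEdge (.base v) (.base w) =
      A.star.cartanForm (A.star.simpleRoot v) (A.star.simpleRoot w) := by
  rw [octopusEdge, octopus_cartanForm, collapse_simpleRoot_base, collapse_simpleRoot_base]

theorem octopusEdge_base_starred (v : A.StarVertex) :
    A.octopusEdge (.base v) .starred =
      A.star.cartanForm (A.star.simpleRoot v) (A.star.simpleRoot .center) := by
  rw [octopusEdge, octopus_cartanForm, collapse_simpleRoot_base, collapse_simpleRoot_starred]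

theorem octopusEdge_starred_base (v : A.StarVertex) :
    A.octopusEdge .starred (.base v) =
      A.star.cartanForm (A.star.simpleRoot .center) (A.star.simpleRoot v) := by
  rw [octopusEdge, octopus_cartanForm, collapse_simpleRoot_base, collapse_simpleRoot_starred]

theorem octopusEdge_starred_starred : A.octopusEdge .starred .starred = 2 := by
  rw [octopusEdge, octopus_cartanForm, collapse_simpleRoot_starred, star_edge_center_center]

theorem octopus_isNormalized (A : WeightTuple) : A.octopus.IsNormalized := by
  rintro (v | _)
  · exact (octopusEdge_base_base v v).trans (A.star_isSimplyLaced.normalized v)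
  · exact octopusEdge_starred_starred

end WeightTuple

/-! ### Commuting conjugates along a chain of type A. -/

/-- The elements `σ, s_0 σ s_0, s_1 s_0 σ s_0 s_1, …`. -/
def conjChain {G : Type*} [Group G] (s : ℕ → G) (σ : G) : ℕ → G
  | 0 => σ
  | j + 1 => s j * conjChain s σ j * s j

/-- Involutions `s_0, …, s_{n-1}` with the relations of type `A_n`, and an element `σ` that
commutes with `s_1, s_2, …` and with its conjugate by `s_0`. The sequence is continued by elements
commuting with everything, such as `1`. -/
structure IsTypeAChain {G : Type*} [Group G] (n : ℕ) (s : ℕ → G) (σ : G) : Prop where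
  mul_self : ∀ k, s k * s k = 1
  comm : ∀ k l, k + 1 < l → Commute (s k) (s l)
  braid : ∀ k, k + 1 < n → s k * s (k + 1) * s k = s (k + 1) * s k * s (k + 1)
  comm_base : ∀ k, 0 < k → Commute (s k) σ
  comm_conj : Commute (s 0 * σ * s 0) σ

namespace IsTypeAChain

variable {G : Type*} [Group G] {n : ℕ} {s : ℕ → G} {σ : G}

theorem mul_self_mul (h : IsTypeAChain n s σ) (k : ℕ) (x : G) : s k * (s k * x) = x := by
  rw [← mul_assoc, h.mul_self, one_mul]

theorem inv_eq (h : IsTypeAChain n s σ) (k : ℕ) : (s k)⁻¹ = s k :=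
  inv_eq_of_mul_eq_one_left (h.mul_self k)

theorem conjChain_succ (s : ℕ → G) (σ : G) (k : ℕ) :
    conjChain s σ (k + 1) = s k * conjChain s σ k * s k := rfl

theorem conj_conjChain_succ (h : IsTypeAChain n s σ) (k : ℕ) :
    s k * conjChain s σ (k + 1) * s k = conjChain s σ k := by
  rw [conjChain_succ]
  simp only [mul_assoc, h.mul_self, h.mul_self_mul, mul_one]

theorem commute_of_lt (h : IsTypeAChain n s σ) {j k : ℕ} (hjk : j < k) :
    Commute (s k) (conjChain s σ j) := by
  induction j with
  | zero => exact h.comm_base k hjk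
  | succ j ih =>
    have := (h.comm j k hjk).symm
    exact (this.mul_right (ih (by omega))).mul_right this

/-- Conjugation by `s k` acts on the chain as the transposition of positions `k` and `k + 1`. The
first new case is position `k + 2`, where the braid relation is needed. -/
theorem commute_of_succ_lt (h : IsTypeAChain n s σ) {j k : ℕ} (hkj : k + 1 < j) (hj : j ≤ n) :
    Commute (s k) (conjChain s σ j) := by
  induction j with
  | zero => omega
  | succ j ih =>
    rcases Nat.lt_or_ge (k + 1) j with hk | hk
    · have := h.comm k j hk
      exact (this.mul_right (ih hk (by omega))).mul_right this
    · obtain rfl : j = k + 1 := by omega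
      have hb := h.braid k (by omega)
      have hc := h.commute_of_lt (Nat.lt_succ_self k)
      rw [Nat.succ_eq_add_one] at hc
      rw [conjChain_succ, conjChain_succ]
      set a := s k
      set b := s (k + 1)
      set t := conjChain s σ k
      change a * (b * (a * t * a) * b) = b * (a * t * a) * b * a
      calc a * (b * (a * t * a) * b) = (a * b * a) * t * a * b := by group
        _ = b * a * (b * t) * a * b := by rw [hb]; group
        _ = b * a * t * (b * a * b) := by rw [hc.eq]; group
        _ = b * (a * t * a) * b * a := by rw [← hb]; group

/-- Everything reduces to positions `0` and `1`, which is `comm_conj`: conjugating by `s l` with `l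
> 0` moves the larger position and fixes `σ`; conjugating by `s j` then moves the smaller one and
fixes the larger. -/
theorem commute_conjChain_of_lt (h : IsTypeAChain n s σ) {j l : ℕ} (hjl : j < l) (hl : l ≤ n) :
    Commute (conjChain s σ l) (conjChain s σ j) := by
  induction j with
  | zero =>
    induction l with
    | zero => omega
    | succ l ih =>
      rcases Nat.eq_zero_or_pos l with rfl | hl0
      · exact h.comm_conj
      · have := h.comm_base l hl0
        exact (this.mul_left (ih (by omega) hl0)).mul_left this
  | succ j ih =>
    have h1 := ih (by omega)
    have h2 := h.commute_of_succ_lt hjl hl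
    have h3 : s j * conjChain s σ l * s j = conjChain s σ l := by
      rw [h2.eq, mul_assoc, h.mul_self, mul_one]
    have h4 := (Commute.conj_iff (s j)).2 h1
    rwa [h.inv_eq, h3] at h4

theorem commute_conjChain (h : IsTypeAChain n s σ) {j l : ℕ} (hj : j ≤ n) (hl : l ≤ n) :
    Commute (conjChain s σ j) (conjChain s σ l) := by
  rcases lt_trichotomy j l with h' | rfl | h'
  · exact (h.commute_conjChain_of_lt h' hl).symm
  · exact Commute.refl _
  · exact h.commute_conjChain_of_lt h' hj

end IsTypeAChain

/-- The quotient of two consecutive elements of the chain. -/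
def chainStep {G : Type*} [Group G] (s : ℕ → G) (σ : G) (j : ℕ) : G :=
  conjChain s σ (j + 1) * (conjChain s σ j)⁻¹

namespace IsTypeAChain

variable {G : Type*} [Group G] {n : ℕ} {s : ℕ → G} {σ : G}

theorem commute_chainStep (h : IsTypeAChain n s σ) {j l : ℕ} (hj : j < n) (hl : l < n) :
    Commute (chainStep s σ j) (chainStep s σ l) :=
  Commute.mul_left
    ((h.commute_conjChain hj hl).mul_right (h.commute_conjChain hj hl.le).inv_right)
    ((h.commute_conjChain hj.le hl).mul_right (h.commute_conjChain hj.le hl.le).inv_right).inv_left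

theorem commute_chainStep_base (h : IsTypeAChain n s σ) {j : ℕ} (hj : j < n) :
    Commute (chainStep s σ j) σ :=
  (h.commute_conjChain hj (Nat.zero_le n)).mul_left
    (h.commute_conjChain hj.le (Nat.zero_le n)).inv_left

theorem conj_mul (h : IsTypeAChain n s σ) (k : ℕ) (x y : G) :
    s k * (x * y⁻¹) * s k = s k * x * s k * (s k * y * s k)⁻¹ := by
  simp only [mul_inv_rev, h.inv_eq, mul_assoc, h.mul_self_mul]

theorem conj_base_zero (s : ℕ → G) (σ : G) : s 0 * σ * s 0 = chainStep s σ 0 * σ := by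
  simp [chainStep, conjChain]

/-- As `s k` interchanges positions `k` and `k + 1`, it inverts their quotient. The same
transposition rule shows that quotients transform like simple roots of type A. -/
theorem conj_chainStep_self (h : IsTypeAChain n s σ) (k : ℕ) :
    s k * chainStep s σ k * s k = (chainStep s σ k)⁻¹ := by
  rw [chainStep, h.conj_mul, h.conj_conjChain_succ, ← conjChain_succ, mul_inv_rev, inv_inv]

theorem conj_chainStep_succ (h : IsTypeAChain n s σ) {k : ℕ} (hk : k + 1 < n) :
    s k * chainStep s σ (k + 1) * s k = chainStep s σ (k + 1) * chainStep s σ k := by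
  rw [chainStep, h.conj_mul, h.conj_conjChain_succ,
    (h.commute_of_succ_lt (Nat.lt_succ_self (k + 1)) hk).eq, mul_assoc, mul_assoc, h.mul_self_mul,
    chainStep]
  group

theorem conj_succ_chainStep (h : IsTypeAChain n s σ) {k : ℕ} (hk : k + 1 < n) :
    s (k + 1) * chainStep s σ k * s (k + 1) = chainStep s σ k * chainStep s σ (k + 1) := by
  rw [(h.commute_chainStep (by omega) hk).eq, chainStep, h.conj_mul, ← conjChain_succ,
    (h.commute_of_lt (Nat.lt_succ_self k)).eq, mul_assoc (conjChain s σ k), h.mul_self, mul_one,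
    chainStep]
  group

theorem commute_chainStep_of_succ_lt (h : IsTypeAChain n s σ) {j k : ℕ} (hk : k + 1 < j)
    (hj : j < n) : Commute (s k) (chainStep s σ j) :=
  (h.commute_of_succ_lt (by omega) hj).mul_right (h.commute_of_succ_lt hk hj.le).inv_right

theorem commute_chainStep_of_lt (h : IsTypeAChain n s σ) {j k : ℕ} (hk : j + 1 < k) :
    Commute (s k) (chainStep s σ j) :=
  (h.commute_of_lt hk).mul_right (h.commute_of_lt (by omega)).inv_right

/-- Multiplicative form of `r_k r_{k+1} α_k = α_{k+1}`. It exhibits every step as a conjugate of the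
first, so relations imposed only at the first vertex of an arm spread along it. -/
theorem chainStep_succ_eq_conj (h : IsTypeAChain n s σ) {k : ℕ} (hk : k + 1 < n) :
    chainStep s σ (k + 1) = s k * s (k + 1) * chainStep s σ k * (s (k + 1) * s k) := by
  have : s k * s (k + 1) * chainStep s σ k * (s (k + 1) * s k) =
      s k * (s (k + 1) * chainStep s σ k * s (k + 1)) * s k := by group
  rw [this, h.conj_succ_chainStep hk, (h.commute_chainStep (by omega) hk).eq]
  have h2 : s k * (chainStep s σ (k + 1) * chainStep s σ k) * s k =
      (s k * chainStep s σ (k + 1) * s k) * (s k * chainStep s σ k * s k) := by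
    simp only [mul_assoc, h.mul_self_mul]
  rw [h2, h.conj_chainStep_succ hk, h.conj_chainStep_self]
  group

/-- An element commuting with all the involutions and the first step commutes with all steps. -/
theorem commute_chainStep_of_commute (h : IsTypeAChain n s σ) {x : G}
    (hx : ∀ k, Commute x (s k)) (h0 : Commute x (chainStep s σ 0)) {j : ℕ} (hj : j < n) :
    Commute x (chainStep s σ j) := by
  induction j with
  | zero => exact h0
  | succ j ih =>
    rw [h.chainStep_succ_eq_conj hj]
    exact (((hx _).mul_right (hx _)).mul_right (ih (by omega))).mul_right
      ((hx _).mul_right (hx _))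

/-- An element `c` commuting with `s_1, s_2, …` and conjugating `σ` and its first conjugate as the
central reflection does, commutes with all steps but the first. -/
theorem commute_chainStep_of_conj {c : G}
    (hcc : c * c = 1) (hc : ∀ k, 0 < k → Commute c (s k)) (hs : ∀ k, 0 < k → Commute (s k) σ)
    (h1 : c * conjChain s σ 1 * c = conjChain s σ 1 * σ⁻¹) {j : ℕ} (hj : 0 < j) :
    Commute c (chainStep s σ j) := by
  -- Every position after `0` acquires the same factor `σ⁻¹`, which cancels in the quotient of two
  -- of them.
  have key : ∀ j, c * conjChain s σ (j + 1) * c = conjChain s σ (j + 1) * σ⁻¹ := by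
    intro j
    induction j with
    | zero => exact h1
    | succ j ih =>
      have hcs := hc (j + 1) (Nat.succ_pos j)
      have hsσ := (hs (j + 1) (Nat.succ_pos j)).inv_right
      rw [conjChain_succ]
      set a := s (j + 1)
      set t := conjChain s σ (j + 1)
      calc c * (a * t * a) * c = (c * a) * t * (a * c) := by group
        _ = (a * c) * t * (c * a) := congrArg₂ (fun x y => x * t * y) hcs.eq hcs.eq.symm
        _ = a * (c * t * c) * a := by group
        _ = a * t * (σ⁻¹ * a) := by rw [ih]; group
        _ = a * t * a * σ⁻¹ := by rw [← hsσ.eq]; group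
  have hinv : c⁻¹ = c := inv_eq_of_mul_eq_one_left hcc
  obtain ⟨j, rfl⟩ := Nat.exists_eq_succ_of_ne_zero hj.ne'
  have : c * chainStep s σ (j + 1) * c⁻¹ = chainStep s σ (j + 1) := by
    rw [chainStep]
    calc c * (conjChain s σ (j + 1 + 1) * (conjChain s σ (j + 1))⁻¹) * c⁻¹
        = (c * conjChain s σ (j + 1 + 1) * c⁻¹) * (c * conjChain s σ (j + 1) * c⁻¹)⁻¹ := by group
      _ = _ := by rw [hinv, key, key]; group
  exact mul_inv_eq_iff_eq_mul.1 this

end IsTypeAChain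

/-! ### The root lattice inside the octopus Coxeter group. -/

namespace WeightTuple

open BoundQuiver

variable {A : WeightTuple}

/-- The canonical map from the free group to `W(T̃_A)`. -/
abbrev toCoxeter (A : WeightTuple) : FreeGroup A.OctopusVertex →* A.OctopusCoxeterGroup :=
  PresentedGroup.mk _

theorem toCoxeter_gen (v : A.OctopusVertex) : A.toCoxeter (A.gen v) = A.coxeterGen v := rfl

theorem toCoxeter_eq {x y : FreeGroup A.OctopusVertex} (h : CoxeterRel A x y) :
    A.toCoxeter x = A.toCoxeter y := by
  rw [← mul_inv_eq_one, ← map_inv, ← map_mul]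
  exact PresentedGroup.one_of_mem ⟨x, y, h, rfl⟩

theorem coxeterGen_mul_self (v : A.OctopusVertex) : A.coxeterGen v * A.coxeterGen v = 1 := by
  have := toCoxeter_eq (CoxeterRel.w0 v)
  rwa [map_pow, toCoxeter_gen, map_one, sq] at this

theorem coxeterGen_comm {v w : A.OctopusVertex} (h : A.octopusEdge v w = 0) :
    Commute (A.coxeterGen v) (A.coxeterGen w) := by
  have := toCoxeter_eq (CoxeterRel.w10 v w h)
  rwa [map_mul, map_mul] at this

theorem coxeterGen_braid {v w : A.OctopusVertex} (h : A.octopusEdge v w = -1) :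
    A.coxeterGen v * A.coxeterGen w * A.coxeterGen v =
      A.coxeterGen w * A.coxeterGen v * A.coxeterGen w := by
  have := toCoxeter_eq (CoxeterRel.w11 v w h)
  simpa only [map_mul, toCoxeter_gen] using this

/-- The generator at a vertex of the star. -/
def baseGen (A : WeightTuple) (v : A.StarVertex) : A.OctopusCoxeterGroup := A.coxeterGen (.base v)

theorem baseGen_mul_self (v : A.StarVertex) : A.baseGen v * A.baseGen v = 1 :=
  coxeterGen_mul_self _

theorem baseGen_inv (v : A.StarVertex) : (A.baseGen v)⁻¹ = A.baseGen v :=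
  inv_eq_of_mul_eq_one_left (baseGen_mul_self v)

theorem baseGen_comm {v w : A.StarVertex}
    (h : A.star.cartanForm (A.star.simpleRoot v) (A.star.simpleRoot w) = 0) :
    Commute (A.baseGen v) (A.baseGen w) :=
  coxeterGen_comm ((octopusEdge_base_base v w).trans h)

theorem baseGen_braid {v w : A.StarVertex}
    (h : A.star.cartanForm (A.star.simpleRoot v) (A.star.simpleRoot w) = -1) :
    A.baseGen v * A.baseGen w * A.baseGen v = A.baseGen w * A.baseGen v * A.baseGen w :=
  coxeterGen_braid ((octopusEdge_base_base v w).trans h)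

/-- The element `σ_1` of `W(T̃_A)`. -/
def sigma (A : WeightTuple) : A.OctopusCoxeterGroup :=
  A.coxeterGen (.base .center) * A.coxeterGen .starred

theorem toCoxeter_sigmaOne : A.toCoxeter A.sigmaOne = A.sigma := rfl

theorem toCoxeter_firstGen (i : Fin A.r) :
    A.toCoxeter (A.firstGen i) = A.baseGen (A.firstVertex i) := rfl

/-- The generators along the `i`-th arm, continued by `1`. -/
def armGen (A : WeightTuple) (i : Fin A.r) (k : ℕ) : A.OctopusCoxeterGroup :=
  if h : k < A.a i - 1 then A.baseGen (.arm i ⟨k, h⟩) else 1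

theorem armGen_of_lt (i : Fin A.r) {k : ℕ} (h : k < A.a i - 1) :
    A.armGen i k = A.baseGen (.arm i ⟨k, h⟩) := dif_pos h

theorem armGen_of_le (i : Fin A.r) {k : ℕ} (h : A.a i - 1 ≤ k) : A.armGen i k = 1 :=
  dif_neg (not_lt.2 h)

theorem armGen_val (i : Fin A.r) (k : Fin (A.a i - 1)) : A.armGen i k = A.baseGen (.arm i k) :=
  armGen_of_lt i k.2

theorem one_le_armLength (A : WeightTuple) (i : Fin A.r) : 0 < A.a i - 1 := by
  have := A.two_le_a i; omega

theorem armGen_zero (i : Fin A.r) : A.armGen i 0 = A.baseGen (A.firstVertex i) :=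
  armGen_of_lt i (A.one_le_armLength i)

/-- An element commuting with the generators of an arm commutes with their continuation. -/
theorem commute_armGen {x : A.OctopusCoxeterGroup} {i : Fin A.r} {k : ℕ}
    (h : ∀ hk : k < A.a i - 1, Commute x (A.baseGen (.arm i ⟨k, hk⟩))) :
    Commute x (A.armGen i k) := by
  by_cases hk : k < A.a i - 1
  · rw [armGen_of_lt i hk]; exact h hk
  · rw [armGen_of_le i (not_lt.1 hk)]; exact Commute.one_right x

theorem center_commute_armGen (i : Fin A.r) {k : ℕ} (hk : 0 < k) :
    Commute (A.baseGen .center) (A.armGen i k) :=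
  commute_armGen fun h => baseGen_comm (by
    rw [star_edge_center_arm, if_neg (by simpa using hk.ne')])

theorem sigma_commute_armGen (i : Fin A.r) {k : ℕ} (hk : 0 < k) :
    Commute A.sigma (A.armGen i k) := by
  refine Commute.mul_left (center_commute_armGen i hk) (commute_armGen fun h => ?_)
  exact coxeterGen_comm (by
    rw [octopusEdge_starred_base, star_edge_center_arm, if_neg (by simpa using hk.ne')])

theorem armGen_commute_armGen_of_ne {i i' : Fin A.r} (h : i ≠ i') (k k' : ℕ) :
    Commute (A.armGen i k) (A.armGen i' k') :=
  commute_armGen fun _ => (commute_armGen fun _ =>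
    baseGen_comm (star_edge_arm_arm_of_ne h.symm _ _)).symm

/-- Relation W2 is exactly `comm_conj`; the other fields are Coxeter relations. Padding by `1` makes
all fields but `braid` hold at every index. -/
theorem isTypeAChain (i : Fin A.r) : IsTypeAChain (A.a i - 1) (A.armGen i) A.sigma where
  mul_self k := by
    by_cases hk : k < A.a i - 1
    · rw [armGen_of_lt i hk, baseGen_mul_self]
    · rw [armGen_of_le i (not_lt.1 hk), mul_one]
  comm k l hkl := commute_armGen fun hl => (commute_armGen fun hk => baseGen_comm (by
    rw [star_edge_arm_arm, if_neg, if_neg] <;> simp <;> omega)).symm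
  braid k hk := by
    rw [armGen_of_lt i hk, armGen_of_lt i (by omega : k < A.a i - 1)]
    refine baseGen_braid ?_
    rw [star_edge_arm_arm, if_neg (by simp), if_pos (by simp)]
  comm_base k hk := (sigma_commute_armGen i hk).symm
  comm_conj := by
    have h := toCoxeter_eq (CoxeterRel.w2 i)
    simp only [map_mul, toCoxeter_firstGen, toCoxeter_sigmaOne] at h
    rw [armGen_zero]
    change _ * _ = _ * _
    rw [h]
    group

/-- The element of `W(T̃_A)` corresponding to the translation by a simple root. -/
def rootElement (A : WeightTuple) : A.StarVertex → A.OctopusCoxeterGroup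
  | .center => A.sigma
  | .arm i j => chainStep (A.armGen i) A.sigma j

theorem conj_sigma_firstGen (i : Fin A.r) :
    A.baseGen (A.firstVertex i) * A.sigma * A.baseGen (A.firstVertex i) =
      A.rootElement (A.firstVertex i) * A.sigma := by
  rw [← armGen_zero]
  exact IsTypeAChain.conj_base_zero _ _

theorem toCoxeter_sigmaFirst (i : Fin A.r) :
    A.toCoxeter (A.sigmaFirst i) = A.rootElement (A.firstVertex i) := by
  rw [sigmaFirst, map_mul, map_mul, map_mul, map_inv, toCoxeter_firstGen, toCoxeter_sigmaOne,
    conj_sigma_firstGen]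
  group

theorem firstGen_commute_rootElement_first {i i' : Fin A.r} (h : i ≠ i') :
    Commute (A.baseGen (A.firstVertex i)) (A.rootElement (A.firstVertex i')) := by
  rcases lt_or_gt_of_ne h with h | h
  · have := toCoxeter_eq (CoxeterRel.w3 i i' h)
    simp only [map_mul, toCoxeter_firstGen, toCoxeter_sigmaFirst] at this
    exact this
  · have := toCoxeter_eq (CoxeterRel.w3' i' i h)
    simp only [map_mul, toCoxeter_firstGen, toCoxeter_sigmaFirst] at this
    exact this

/-- Only the first step of the other arm matters. For `k = 0` this is W3; for `k > 0` the generator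
commutes with `σ_1` and with the whole other arm. -/
theorem armGen_commute_rootElement {i i' : Fin A.r} (h : i ≠ i') (k : ℕ)
    (j : Fin (A.a i' - 1)) : Commute (A.armGen i k) (A.rootElement (.arm i' j)) := by
  refine (isTypeAChain i').commute_chainStep_of_commute
    (fun l => armGen_commute_armGen_of_ne h k l) ?_ j.2
  cases k with
  | zero =>
    rw [armGen_zero]
    exact firstGen_commute_rootElement_first h
  | succ k =>
    have h0 : ∀ l, Commute (A.armGen i (k + 1)) (conjChain (A.armGen i') A.sigma l) := by
      intro l
      induction l with
      | zero => exact (sigma_commute_armGen i (Nat.succ_pos k)).symm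
      | succ l ih =>
        have := armGen_commute_armGen_of_ne h (k + 1) l
        exact (this.mul_right ih).mul_right this
    exact (h0 1).mul_right (h0 0).inv_right

theorem sigma_commute_rootElement (v : A.StarVertex) : Commute A.sigma (A.rootElement v) := by
  match v with
  | .center => exact Commute.refl _
  | .arm i j => exact ((isTypeAChain i).commute_chainStep_base j.2).symm

/-- For different arms, the element of the second arm commutes with `σ_1` and with the generators of
the first arm, hence with all conjugates of `σ_1` along the first arm. -/
theorem rootElement_commute (v w : A.StarVertex) :
    Commute (A.rootElement v) (A.rootElement w) := by
  match v, w with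
  | .center, w => exact sigma_commute_rootElement w
  | v, .center => exact (sigma_commute_rootElement v).symm
  | .arm i j, .arm i' j' =>
    by_cases h : i = i'
    · subst h
      exact (isTypeAChain i).commute_chainStep j.2 j'.2
    · have key : ∀ l, Commute (conjChain (A.armGen i) A.sigma l) (A.rootElement (.arm i' j')) := by
        intro l
        induction l with
        | zero => exact sigma_commute_rootElement _
        | succ l ih =>
          have := armGen_commute_rootElement h l j'
          exact (this.mul_left ih).mul_left this
      exact (key _).mul_left (key _).inv_left

/-- A product of two involutions is inverted by conjugation with either of them. -/
theorem conj_center_sigma : A.baseGen .center * A.sigma * A.baseGen .center = A.sigma⁻¹ := by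
  have h1 := coxeterGen_mul_self (.base .center : A.OctopusVertex)
  have h2 := coxeterGen_mul_self (.starred : A.OctopusVertex)
  rw [sigma, baseGen, mul_inv_rev, inv_eq_of_mul_eq_one_left h1, inv_eq_of_mul_eq_one_left h2,
    ← mul_assoc, h1, one_mul]

/-- Besides the braid relation of `w̃_{(i,1)}` with `w̃_1`, this needs the one with `w̃_{1*}`. -/
theorem conj_center_rootElement_first (i : Fin A.r) :
    A.baseGen .center * A.rootElement (A.firstVertex i) * A.baseGen .center =
      A.rootElement (A.firstVertex i) * A.sigma := by
  have hb : A.baseGen .center * A.baseGen (A.firstVertex i) * A.baseGen .center =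
      A.baseGen (A.firstVertex i) * A.baseGen .center * A.baseGen (A.firstVertex i) :=
    baseGen_braid (by rw [firstVertex, star_edge_center_arm, if_pos rfl])
  have hs : A.coxeterGen .starred * A.baseGen (A.firstVertex i) * A.coxeterGen .starred =
      A.baseGen (A.firstVertex i) * A.coxeterGen .starred * A.baseGen (A.firstVertex i) :=
    coxeterGen_braid (by
      rw [octopusEdge_starred_base, firstVertex, star_edge_center_arm, if_pos rfl])
  have hσ : A.sigma = A.baseGen .center * A.coxeterGen .starred := rfl
  rw [eq_mul_inv_of_mul_eq (conj_sigma_firstGen i).symm]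
  have hss := coxeterGen_mul_self (.starred : A.OctopusVertex)
  have hcc := baseGen_mul_self (.center : A.StarVertex)
  have hff := baseGen_mul_self (A.firstVertex i)
  have hsi := inv_eq_of_mul_eq_one_left hss
  have hci := inv_eq_of_mul_eq_one_left hcc
  rw [hσ]
  set f := A.baseGen (A.firstVertex i)
  set c := A.baseGen .center
  set s := A.coxeterGen .starred
  calc c * (f * (c * s) * f * (c * s)⁻¹) * c = (c * f * c) * s * f * s⁻¹ * (c⁻¹ * c) := by group
    _ = f * c * (f * s * f) * s⁻¹ := by rw [hb]; group
    _ = f * c * s * f := by rw [← hs]; group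
    _ = f * (c * s) * f * (c * s)⁻¹ * (c * s) := by group

theorem center_commute_rootElement (i : Fin A.r) (j : Fin (A.a i - 1)) (hj : 0 < (j : ℕ)) :
    Commute (A.baseGen .center) (A.rootElement (.arm i j)) := by
  refine IsTypeAChain.commute_chainStep_of_conj (baseGen_mul_self _)
    (fun k hk => center_commute_armGen i hk) (fun k hk => (sigma_commute_armGen i hk).symm) ?_ hj
  have h1 : conjChain (A.armGen i) A.sigma 1 = A.rootElement (A.firstVertex i) * A.sigma := by
    rw [← conj_sigma_firstGen, ← armGen_zero]; rfl
  rw [h1]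
  have hcc := baseGen_mul_self (.center : A.StarVertex)
  calc A.baseGen .center * (A.rootElement (A.firstVertex i) * A.sigma) * A.baseGen .center
      = (A.baseGen .center * A.rootElement (A.firstVertex i) * A.baseGen .center) *
          (A.baseGen .center * A.baseGen .center)⁻¹ *
          (A.baseGen .center * A.sigma * A.baseGen .center) := by group
    _ = _ := by rw [conj_center_rootElement_first, conj_center_sigma, hcc]; group

/-- Conjugation by a generator acts on the translations as a simple reflection. -/
theorem conj_rootElement (v u : A.StarVertex) :
    A.baseGen v * A.rootElement u * A.baseGen v =
      A.rootElement u * A.rootElement v ^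
        (-A.star.cartanForm (A.star.simpleRoot u) (A.star.simpleRoot v)) := by
  have hcomm : ∀ {v u}, Commute (A.baseGen v) (A.rootElement u) →
      A.baseGen v * A.rootElement u * A.baseGen v = A.rootElement u := by
    intro v u h
    rw [h.eq, mul_assoc, baseGen_mul_self, mul_one]
  match v, u with
  | .center, .center =>
    rw [star_edge_center_center]
    change A.baseGen .center * A.sigma * A.baseGen .center = A.sigma * A.sigma ^ (-2 : ℤ)
    rw [conj_center_sigma]
    group
  | .center, .arm i j =>
    rw [star_edge_arm_center]
    split_ifs with hj
    · have : j = ⟨0, A.one_le_armLength i⟩ := Fin.ext hj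
      subst this
      rw [neg_neg, zpow_one]
      exact conj_center_rootElement_first i
    · rw [neg_zero, zpow_zero, mul_one]
      exact hcomm (center_commute_rootElement i j (Nat.pos_of_ne_zero hj))
  | .arm i k, .center =>
    rw [star_edge_center_arm]
    split_ifs with hk
    · have : k = ⟨0, A.one_le_armLength i⟩ := Fin.ext hk
      subst this
      rw [neg_neg, zpow_one, (rootElement_commute _ _).eq]
      exact conj_sigma_firstGen i
    · rw [neg_zero, zpow_zero, mul_one]
      exact hcomm (v := .arm i k) (u := .center) (armGen_val i k ▸ (sigma_commute_armGen i (Nat.pos_of_ne_zero hk)).symm)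
  | .arm i k, .arm i' j =>
    by_cases hi : i = i'
    · subst hi
      have hA := isTypeAChain i
      rw [star_edge_arm_arm]
      split_ifs with h1 h2
      · subst h1
        rw [← armGen_val]
        refine (hA.conj_chainStep_self j).trans ?_
        change _ = chainStep _ _ _ * chainStep _ _ _ ^ _
        group
      · rw [← armGen_val, neg_neg, zpow_one]
        obtain ⟨k, hk⟩ := k
        obtain ⟨j, hj⟩ := j
        rcases h2 with h2 | h2
        · obtain rfl : j = k + 1 := h2
          exact hA.conj_chainStep_succ hj
        · obtain rfl : k = j + 1 := h2
          exact hA.conj_succ_chainStep hk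
      · rw [neg_zero, zpow_zero, mul_one]
        refine hcomm ?_
        rw [← armGen_val]
        rw [Fin.ext_iff] at h1
        rcases Nat.lt_or_ge ((k : ℕ) + 1) j with h | h
        · exact hA.commute_chainStep_of_succ_lt h j.2
        · exact hA.commute_chainStep_of_lt (by omega)
    · rw [star_edge_arm_arm_of_ne (Ne.symm hi), neg_zero, zpow_zero, mul_one]
      exact hcomm (armGen_val i k ▸ armGen_commute_rootElement hi k j)

end WeightTuple

/-! ### Homomorphisms out of the root lattice. -/

section LatticeHom

open Multiplicative

variable {V : Type} [Fintype V] [DecidableEq V] {G : Type*} [Group G]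

theorem lattice_mem {H : Subgroup (Multiplicative (V → ℤ))}
    (h : ∀ v, ofAdd (Pi.single v 1) ∈ H) (x : Multiplicative (V → ℤ)) : x ∈ H := by
  have hx : x = ∏ v, ofAdd (Pi.single v 1 : V → ℤ) ^ toAdd x v := by
    apply toAdd.injective
    rw [toAdd_prod]
    ext u
    simp [Finset.sum_apply, Pi.single_apply]
  rw [hx]
  exact Subgroup.prod_mem _ fun v _ => zpow_mem (h v) _

theorem lattice_hom_ext {F F' : Multiplicative (V → ℤ) →* G}
    (h : ∀ v, F (ofAdd (Pi.single v 1)) = F' (ofAdd (Pi.single v 1))) : F = F' :=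
  MonoidHom.ext fun x => lattice_mem (H := F.eqLocus F') h x

theorem exists_lattice_hom {τ : V → G} (h : ∀ v w, Commute (τ v) (τ w)) :
    ∃ F : Multiplicative (V → ℤ) →* G, ∀ v, F (ofAdd (Pi.single v 1)) = τ v := by
  let e : Multiplicative (V → ℤ) →* (V → Multiplicative ℤ) :=
    { toFun := fun x v => ofAdd (toAdd x v)
      map_one' := rfl
      map_mul' := fun _ _ => rfl }
  have hc : Pairwise fun v w => ∀ x y, Commute (zpowersHom G (τ v) x) (zpowersHom G (τ w) y) := by
    intro v w _ x y
    rw [zpowersHom_apply, zpowersHom_apply]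
    exact ((h v w).zpow_left _).zpow_right _
  refine ⟨(MonoidHom.noncommPiCoprod (fun v => zpowersHom G (τ v)) hc).comp e, fun v => ?_⟩
  · have : e (ofAdd (Pi.single v 1)) = Pi.mulSingle v (ofAdd 1) := by
      ext u
      simp only [e, MonoidHom.coe_mk, OneHom.coe_mk, toAdd_ofAdd, Pi.single_apply,
        Pi.mulSingle_apply]
      split_ifs <;> rfl
    rw [MonoidHom.comp_apply, this, MonoidHom.noncommPiCoprod_mulSingle]
    simp

end LatticeHom

/-! ### Calculation in the semidirect product. -/

namespace BoundQuiver

open Multiplicative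

variable {V E R : Type} [Fintype V] [DecidableEq V] [Fintype E] [Fintype R]
  {Q : BoundQuiver V E R}

/-- The translation by `x` in `W ⋉ K_0`. -/
def translation (Q : BoundQuiver V E R) (x : V → ℤ) : Q.WeylSemidirect :=
  SemidirectProduct.inl (ofAdd x)

/-- The simple reflection at `v` in `W ⋉ K_0`. -/
def IsNormalized.affineSimple (hQ : Q.IsNormalized) (v : V) : Q.WeylSemidirect :=
  SemidirectProduct.inr (hQ.weylSimple v)

theorem translation_mul (x y : V → ℤ) :
    Q.translation x * Q.translation y = Q.translation (x + y) := by
  rw [translation, translation, ← map_mul]; rfl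

theorem translation_inv (x : V → ℤ) : (Q.translation x)⁻¹ = Q.translation (-x) := by
  rw [translation, ← map_inv]; rfl

theorem translation_zero : Q.translation 0 = 1 := map_one _

theorem IsNormalized.weylSimple_mul_self (hQ : Q.IsNormalized) (v : V) :
    hQ.weylSimple v * hQ.weylSimple v = 1 := Subtype.ext (hQ.simpleReflection_mul_self v)

theorem IsNormalized.affineSimple_mul_self (hQ : Q.IsNormalized) (v : V) :
    hQ.affineSimple v * hQ.affineSimple v = 1 := by
  rw [affineSimple, ← map_mul, weylSimple_mul_self, map_one]

theorem IsNormalized.affineSimple_mul_self_mul (hQ : Q.IsNormalized) (v : V)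
    (y : Q.WeylSemidirect) : hQ.affineSimple v * (hQ.affineSimple v * y) = y := by
  rw [← mul_assoc, affineSimple_mul_self, one_mul]

theorem IsNormalized.affineSimple_comm (hQ : Q.IsNormalized) {v w : V}
    (h : Q.cartanForm (Q.simpleRoot v) (Q.simpleRoot w) = 0) :
    hQ.affineSimple v * hQ.affineSimple w = hQ.affineSimple w * hQ.affineSimple v := by
  rw [affineSimple, affineSimple, ← map_mul, ← map_mul]
  exact congr_arg _ (Subtype.ext (hQ.simpleReflection_comm h))

theorem IsNormalized.affineSimple_braid (hQ : Q.IsNormalized) {v w : V}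
    (h : Q.cartanForm (Q.simpleRoot v) (Q.simpleRoot w) = -1) :
    hQ.affineSimple v * hQ.affineSimple w * hQ.affineSimple v =
      hQ.affineSimple w * hQ.affineSimple v * hQ.affineSimple w := by
  rw [affineSimple, affineSimple, ← map_mul, ← map_mul, ← map_mul, ← map_mul]
  exact congr_arg _ (Subtype.ext (hQ.simpleReflection_braid h))

/-- Used as a rewriting rule: it pushes translations to the right, so that an identity of words
splits into a Coxeter identity and an identity of lattice vectors. -/
theorem IsNormalized.translation_mul_affineSimple (hQ : Q.IsNormalized) (v : V) (x : V → ℤ) :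
    Q.translation x * hQ.affineSimple v =
      hQ.affineSimple v * Q.translation (hQ.simpleReflection v x) := by
  have h := SemidirectProduct.inl_aut (φ := Q.weylAction) (hQ.weylSimple v) (ofAdd x)
  have hinv : (hQ.affineSimple v)⁻¹ = hQ.affineSimple v :=
    inv_eq_of_mul_eq_one_left (hQ.affineSimple_mul_self v)
  have h' : Q.translation (hQ.simpleReflection v x) =
      hQ.affineSimple v * Q.translation x * (hQ.affineSimple v)⁻¹ := by
    refine Eq.trans ?_ (h.trans ?_)
    · rfl
    · rw [map_inv]; rfl
  rw [h', hinv, mul_assoc, affineSimple_mul_self_mul]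

theorem IsNormalized.translation_mul_affineSimple_mul (hQ : Q.IsNormalized) (v : V) (x : V → ℤ)
    (y : Q.WeylSemidirect) : Q.translation x * (hQ.affineSimple v * y) =
      hQ.affineSimple v * (Q.translation (hQ.simpleReflection v x) * y) := by
  rw [← mul_assoc, translation_mul_affineSimple, mul_assoc]

end BoundQuiver

/-! ### The isomorphism with `W(R_A) ⋉ K_0(R_A)`. -/

namespace WeightTuple

open BoundQuiver Multiplicative

variable {A : WeightTuple}

theorem star_isNormalized (A : WeightTuple) : A.star.IsNormalized := A.star_isSimplyLaced.normalized

/-- The images of the generators of `W(T̃_A)` in `W(R_A) ⋉ K_0(R_A)`. -/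
def affineGen (A : WeightTuple) : A.OctopusVertex → A.star.WeylSemidirect
  | .base v => A.star_isNormalized.affineSimple v
  -- Forced by `σ_1 ↦ α_1`, as `r_1` is an involution.
  | .starred => A.star_isNormalized.affineSimple .center *
      A.star.translation (A.star.simpleRoot .center)

theorem edge_center_first (i : Fin A.r) :
    A.star.cartanForm (A.star.simpleRoot .center) (A.star.simpleRoot (A.firstVertex i)) = -1 := by
  rw [firstVertex, star_edge_center_arm, if_pos rfl]

theorem affineGen_starred_comm {v : A.StarVertex}
    (h : A.star.cartanForm (A.star.simpleRoot .center) (A.star.simpleRoot v) = 0) :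
    A.affineGen .starred * A.affineGen (.base v) = A.affineGen (.base v) * A.affineGen .starred := by
  have hN := A.star_isNormalized
  simp only [affineGen]
  rw [mul_assoc, hN.translation_mul_affineSimple, hN.simpleReflection_apply, h, zero_smul, sub_zero,
    ← mul_assoc, hN.affineSimple_comm h, mul_assoc]

theorem affineGen_starred_braid {v : A.StarVertex}
    (h : A.star.cartanForm (A.star.simpleRoot .center) (A.star.simpleRoot v) = -1) :
    A.affineGen .starred * A.affineGen (.base v) * A.affineGen .starred =
      A.affineGen (.base v) * A.affineGen .starred * A.affineGen (.base v) := by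
  have hN := A.star_isNormalized
  have h' := h
  rw [cartanForm_comm] at h'
  have hb := hN.affineSimple_braid h
  simp only [affineGen]
  simp only [mul_assoc, hN.translation_mul_affineSimple, hN.translation_mul_affineSimple_mul,
    translation_mul] at hb ⊢
  rw [← mul_assoc _ (hN.affineSimple v), ← mul_assoc, mul_assoc _ (hN.affineSimple v), hb]
  simp only [mul_assoc]
  congr 4
  simp only [hN.simpleReflection_apply, cartanForm_sub_left, cartanForm_smul_left, h, h',
    star_edge_center_center]
  module

theorem lift_affineGen_sigmaOne : FreeGroup.lift A.affineGen A.sigmaOne =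
    A.star.translation (A.star.simpleRoot .center) := by
  rw [sigmaOne, map_mul, gen, gen, FreeGroup.lift_apply_of, FreeGroup.lift_apply_of]
  exact A.star_isNormalized.affineSimple_mul_self_mul _ _

theorem lift_affineGen_firstGen (i : Fin A.r) : FreeGroup.lift A.affineGen (A.firstGen i) =
    A.star_isNormalized.affineSimple (A.firstVertex i) := FreeGroup.lift_apply_of

theorem lift_affineGen_sigmaFirst (i : Fin A.r) : FreeGroup.lift A.affineGen (A.sigmaFirst i) =
    A.star.translation (A.star.simpleRoot (A.firstVertex i)) := by
  have hN := A.star_isNormalized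
  simp only [sigmaFirst, map_mul, map_inv, lift_affineGen_sigmaOne, lift_affineGen_firstGen]
  rw [mul_assoc (hN.affineSimple _), hN.translation_mul_affineSimple, hN.affineSimple_mul_self_mul,
    translation_inv, translation_mul, hN.simpleReflection_apply, edge_center_first]
  congr 1
  module

theorem affineSimple_commute_translation_first {i j : Fin A.r} (h : i ≠ j) :
    A.star_isNormalized.affineSimple (A.firstVertex i) *
        A.star.translation (A.star.simpleRoot (A.firstVertex j)) =
      A.star.translation (A.star.simpleRoot (A.firstVertex j)) *
        A.star_isNormalized.affineSimple (A.firstVertex i) := by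
  rw [IsNormalized.translation_mul_affineSimple, IsNormalized.simpleReflection_apply,
    firstVertex, firstVertex, star_edge_arm_arm_of_ne h.symm, zero_smul, sub_zero]

theorem lift_affineGen_eq {x y : FreeGroup A.OctopusVertex} (h : CoxeterRel A x y) :
    FreeGroup.lift A.affineGen x = FreeGroup.lift A.affineGen y := by
  have hN := A.star_isNormalized
  have hof : ∀ v, FreeGroup.lift A.affineGen (A.gen v) = A.affineGen v :=
    fun v => FreeGroup.lift_apply_of
  induction h with
  | w0 v =>
    rw [map_pow, hof, map_one, sq]
    match v with
    | .base v => exact hN.affineSimple_mul_self v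
    | .starred =>
      simp only [affineGen, mul_assoc, hN.translation_mul_affineSimple_mul,
        hN.affineSimple_mul_self_mul, translation_mul, hN.simpleReflection_apply,
        star_edge_center_center]
      rw [← translation_zero]
      congr 1
      module
  | w10 v w h =>
    rw [map_mul, map_mul, hof, hof]
    match v, w with
    | .base v, .base w => exact hN.affineSimple_comm ((octopusEdge_base_base v w).symm.trans h)
    | .starred, .base w => exact affineGen_starred_comm ((octopusEdge_starred_base w).symm.trans h)
    | .base v, .starred =>
      rw [octopusEdge_base_starred, cartanForm_comm] at h
      exact (affineGen_starred_comm h).symm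
    | .starred, .starred => rfl
  | w11 v w h =>
    rw [map_mul, map_mul, map_mul, map_mul, hof, hof]
    match v, w with
    | .base v, .base w => exact hN.affineSimple_braid ((octopusEdge_base_base v w).symm.trans h)
    | .starred, .base w => exact affineGen_starred_braid ((octopusEdge_starred_base w).symm.trans h)
    | .base v, .starred =>
      rw [octopusEdge_base_starred, cartanForm_comm] at h
      exact (affineGen_starred_braid h).symm
    | .starred, .starred => rfl
  -- The reflections cancel in pairs, so both sides are translations and W2 holds because the
  -- lattice is abelian. W3 holds below because `α_{(i,1)}` and `α_{(j,1)}` are orthogonal.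
  | w2 i =>
    simp only [map_mul, lift_affineGen_sigmaOne, lift_affineGen_firstGen]
    simp only [mul_assoc, hN.translation_mul_affineSimple, hN.affineSimple_mul_self_mul,
      translation_mul]
    congr 1
    simp only [hN.simpleReflection_apply, cartanForm_sub_left, cartanForm_add_left,
      cartanForm_smul_left, edge_center_first, hN (A.firstVertex i)]
    module
  | w3 i j h =>
    rw [map_mul, map_mul, lift_affineGen_firstGen, lift_affineGen_sigmaFirst,
      affineSimple_commute_translation_first h.ne]
  | w3' i j h =>
    rw [map_mul, map_mul, lift_affineGen_firstGen, lift_affineGen_sigmaFirst,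
      affineSimple_commute_translation_first h.ne']

/-- The homomorphism `W(T̃_A) → W(R_A) ⋉ K_0(R_A)`. -/
def toAffine (A : WeightTuple) : A.OctopusCoxeterGroup →* A.star.WeylSemidirect :=
  PresentedGroup.toGroup (f := A.affineGen) (by
    rintro _ ⟨x, y, h, rfl⟩
    rw [map_mul, map_inv, lift_affineGen_eq h, mul_inv_cancel])

theorem toAffine_coxeterGen (v : A.OctopusVertex) :
    A.toAffine (A.coxeterGen v) = A.affineGen v := PresentedGroup.toGroup.of _

/-- The compatibility required to glue `F` and `s`. It passes to products and inverses in the Weyl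
group; for a simple reflection it is checked on simple roots, where it is `conj_rootElement`. -/
theorem conj_lattice_hom {F : Multiplicative (A.StarVertex → ℤ) →* A.OctopusCoxeterGroup}
    (hF : ∀ v, F (ofAdd (A.star.simpleRoot v)) = A.rootElement v)
    {s : A.star.weylGroup →* A.OctopusCoxeterGroup}
    (hs : ∀ v, s (A.star_isNormalized.weylSimple v) = A.baseGen v) (g : A.star.weylGroup) :
    ∀ x, F (A.star.weylAction g x) = s g * F x * (s g)⁻¹ := by
  have hg : g ∈ Subgroup.closure (Set.range A.star_isNormalized.weylSimple) := by
    rw [IsNormalized.closure_range_weylSimple]; exact Subgroup.mem_top g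
  induction hg using Subgroup.closure_induction with
  | mem g hg =>
    obtain ⟨v, rfl⟩ := hg
    suffices h : F.comp (A.star.weylAction (A.star_isNormalized.weylSimple v)).toMonoidHom =
        (MulAut.conj (s (A.star_isNormalized.weylSimple v))).toMonoidHom.comp F from
      fun x => DFunLike.congr_fun h x
    refine lattice_hom_ext fun u => ?_
    change F (ofAdd (A.star_isNormalized.simpleReflection v (A.star.simpleRoot u))) =
      s (A.star_isNormalized.weylSimple v) * F (ofAdd (A.star.simpleRoot u)) *
        (s (A.star_isNormalized.weylSimple v))⁻¹
    rw [hs, baseGen_inv, hF, conj_rootElement, IsNormalized.simpleReflection_apply, sub_eq_add_neg,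
      ← neg_smul, ofAdd_add, map_mul, ofAdd_zsmul, map_zpow, hF, hF]
  | one => intro x; simp
  | mul g h _ _ hg hh =>
    intro x
    rw [map_mul, MulAut.mul_apply, hg, hh, map_mul]
    group
  | inv g _ hg =>
    intro x
    have := hg ((A.star.weylAction g)⁻¹ x)
    rw [MulAut.apply_inv_self] at this
    rw [map_inv, map_inv, this]
    group

/-- If `I(α_u, α_v) = -1`, then `r_v α_u - α_u = α_v`; translations are thus obtained outwards from
the center. -/
theorem translation_mem_range (v : A.StarVertex) :
    A.star.translation (A.star.simpleRoot v) ∈ A.toAffine.range := by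
  have hN := A.star_isNormalized
  have hs : ∀ v, hN.affineSimple v ∈ A.toAffine.range := fun v => ⟨_, toAffine_coxeterGen (.base v)⟩
  have hc : A.star.translation (A.star.simpleRoot .center) ∈ A.toAffine.range :=
    ⟨A.sigma, by
      rw [sigma, map_mul, toAffine_coxeterGen, toAffine_coxeterGen]
      exact hN.affineSimple_mul_self_mul _ _⟩
  have step : ∀ {u v}, A.star.translation (A.star.simpleRoot u) ∈ A.toAffine.range →
      A.star.cartanForm (A.star.simpleRoot u) (A.star.simpleRoot v) = -1 →
      A.star.translation (A.star.simpleRoot v) ∈ A.toAffine.range := by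
    intro u v hu h
    have : A.star.translation (A.star.simpleRoot v) =
        hN.affineSimple v * A.star.translation (A.star.simpleRoot u) * hN.affineSimple v *
          (A.star.translation (A.star.simpleRoot u))⁻¹ := by
      rw [mul_assoc (hN.affineSimple v), hN.translation_mul_affineSimple,
        hN.affineSimple_mul_self_mul, translation_inv, translation_mul,
        hN.simpleReflection_apply, h]
      congr 1
      module
    rw [this]
    exact mul_mem (mul_mem (mul_mem (hs v) hu) (hs v)) (inv_mem hu)
  match v with
  | .center => exact hc
  | .arm i ⟨j, hj⟩ =>
    induction j with
    | zero => exact step hc (edge_center_first i)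
    | succ j ih =>
      refine step (ih (by omega)) ?_
      rw [star_edge_arm_arm, if_neg (by simp), if_pos (by simp)]

theorem toAffine_surjective (A : WeightTuple) : Function.Surjective A.toAffine := by
  rw [← MonoidHom.range_eq_top, eq_top_iff]
  intro g _
  rw [← SemidirectProduct.inl_left_mul_inr_right g]
  refine mul_mem ?_ ?_
  · exact lattice_mem (H := A.toAffine.range.comap SemidirectProduct.inl)
      (fun v => translation_mem_range v) g.left
  · have h : Subgroup.closure (Set.range A.star_isNormalized.weylSimple) ≤
        A.toAffine.range.comap SemidirectProduct.inr := by
      rw [Subgroup.closure_le]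
      rintro _ ⟨v, rfl⟩
      exact ⟨_, toAffine_coxeterGen (.base v)⟩
    rw [IsNormalized.closure_range_weylSimple] at h
    exact h (Subgroup.mem_top g.right)

/-- As `toAffine` is surjective, the glued map `Ψ` need only be a left inverse, which is checked on
generators. -/
theorem exists_affineEquiv (A : WeightTuple) :
    ∃ Φ : A.OctopusCoxeterGroup ≃* A.star.WeylSemidirect,
      ∀ v, Φ (A.coxeterGen v) = A.affineGen v := by
  obtain ⟨F, hF⟩ := exists_lattice_hom (rootElement_commute (A := A))
  obtain ⟨s, hs⟩ := A.star_isSimplyLaced.exists_weylLift (f := A.baseGen) baseGen_mul_self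
    (fun v w h => baseGen_comm h) (fun v w h => baseGen_braid h)
  have hconj := conj_lattice_hom hF hs
  let Ψ : A.star.WeylSemidirect →* A.OctopusCoxeterGroup :=
    SemidirectProduct.lift F s fun g => MonoidHom.ext fun x => hconj g x
  have hΨt : ∀ v, Ψ (A.star.translation (A.star.simpleRoot v)) = A.rootElement v := fun v =>
    (SemidirectProduct.lift_inl _ _ _ _).trans (hF v)
  have hΨs : ∀ v, Ψ (A.star_isNormalized.affineSimple v) = A.baseGen v := fun v =>
    (SemidirectProduct.lift_inr _ _ _ _).trans (hs v)
  have h1 : Ψ.comp A.toAffine = MonoidHom.id _ := by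
    refine PresentedGroup.ext fun v => ?_
    change Ψ (A.toAffine (A.coxeterGen v)) = A.coxeterGen v
    rw [toAffine_coxeterGen]
    match v with
    | .base v => exact hΨs v
    | .starred =>
      rw [affineGen, map_mul, hΨt, hΨs]
      change A.baseGen .center * (A.baseGen .center * _) = _
      rw [← mul_assoc, baseGen_mul_self, one_mul]
  have hinj : Function.Injective A.toAffine :=
    Function.LeftInverse.injective (g := Ψ) fun x => DFunLike.congr_fun h1 x
  exact ⟨MulEquiv.ofBijective A.toAffine ⟨hinj, A.toAffine_surjective⟩, toAffine_coxeterGen⟩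

end WeightTuple

/-! ### Splittings of central extensions by `ℤ`. -/

/-- A section `s` gives `h ↦ h s(π h)⁻¹`, which is multiplicative because the kernel is central and
restricts to the identity there. Followed by `e`, it would be a nontrivial homomorphism to `ℤ`. -/
theorem not_split_of_hom_int_trivial {H G : Type*} [Group H] [Group G] {π : H →* G}
    (hcentral : π.ker ≤ Subgroup.center H) (e : π.ker ≃* Multiplicative ℤ)
    (htriv : ∀ F : H →* Multiplicative ℤ, F = 1) : ¬ ∃ s : G →* H, π.comp s = MonoidHom.id G := by
  rintro ⟨s, hs⟩
  have hs' : ∀ g, π (s g) = g := fun g => DFunLike.congr_fun hs g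
  have hker : ∀ h, h * (s (π h))⁻¹ ∈ π.ker := fun h => by
    rw [MonoidHom.mem_ker, map_mul, map_inv, hs', mul_inv_cancel]
  let ρ : H →* π.ker :=
    { toFun := fun h => ⟨h * (s (π h))⁻¹, hker h⟩
      map_one' := by simp
      map_mul' := fun g h => Subtype.ext <| by
        have hc := Subgroup.mem_center_iff.1 (hcentral (hker h)) (s (π g))⁻¹
        simp only [map_mul, mul_inv_rev, Subgroup.coe_mul]
        calc g * h * ((s (π h))⁻¹ * (s (π g))⁻¹) = g * (h * (s (π h))⁻¹ * (s (π g))⁻¹) := by group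
          _ = _ := by rw [← hc]; group }
  have hρ : ∀ z : π.ker, ρ z = z := fun z => Subtype.ext <| by
    have : π z = 1 := z.2
    change (z : H) * (s (π z))⁻¹ = z
    rw [this, map_one, inv_one, mul_one]
  have h1 := DFunLike.congr_fun (htriv (e.toMonoidHom.comp ρ))
    (e.symm (Multiplicative.ofAdd 1) : H)
  rw [MonoidHom.comp_apply, hρ] at h1
  have h2 : Multiplicative.ofAdd (1 : ℤ) = 1 := (e.apply_symm_apply _).symm.trans h1
  exact absurd (congr_arg Multiplicative.toAdd h2) one_ne_zero

/-! ### The action on the octopus lattice. -/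

namespace WeightTuple

open BoundQuiver Multiplicative

variable {A : WeightTuple}

theorem octopus_ext {x y : A.OctopusVertex → ℤ} (h : A.collapse x = A.collapse y)
    (hs : x .starred = y .starred) : x = y := by
  ext v
  match v with
  | .starred => exact hs
  | .base v =>
    have := congr_fun h v
    simp only [collapse, LinearMap.coe_mk, AddHom.coe_mk, hs] at this
    linarith

/-- The octopus lattice is the sum of the star lattice and `ℤ (α̃_{1*} - α̃_1)`. -/
def octopusEquiv (A : WeightTuple) : (A.OctopusVertex → ℤ) ≃ₗ[ℤ] (A.StarVertex → ℤ) × ℤ where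
  toFun x := (A.collapse x, x .starred)
  map_add' x y := by rw [map_add]; rfl
  map_smul' c x := by rw [map_smul]; rfl
  invFun y := fun v => match v with
    | .base v => y.1 v - y.2 * A.star.simpleRoot .center v
    | .starred => y.2
  left_inv x := octopus_ext (by ext v; simp [collapse]) rfl
  right_inv y := by
    refine Prod.ext ?_ rfl
    ext v
    simp [collapse]

theorem octopusEquiv_apply (x : A.OctopusVertex → ℤ) :
    A.octopusEquiv x = (A.collapse x, x .starred) := rfl

/-- The action of `(x, w)` on `K_0 ⊕ ℤ` by `(λ, n) ↦ (w λ, n - I(w λ, x))`. -/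
def affineEnd (g : A.star.WeylSemidirect) : Module.End ℤ ((A.StarVertex → ℤ) × ℤ) where
  toFun y := (g.right.1 y.1, y.2 - A.star.cartanForm (g.right.1 y.1) (toAdd g.left))
  map_add' y z := by
    refine Prod.ext (map_add _ _ _) ?_
    simp only [Prod.fst_add, Prod.snd_add, map_add, cartanForm_add_left]
    ring
  map_smul' c y := by
    refine Prod.ext (g.right.1.map_smul c y.1) ?_
    simp only [Prod.smul_fst, Prod.smul_snd, map_smul, cartanForm_smul_left, smul_eq_mul,
      RingHom.id_apply]
    ring

/-- Invariance of the form under the Weyl group turns `I(w w' λ, w x')` into `I(w' λ, x')`, which is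
the cocycle identity needed. -/
theorem affineEnd_mul (g h : A.star.WeylSemidirect) (y : (A.StarVertex → ℤ) × ℤ) :
    affineEnd (g * h) y = affineEnd g (affineEnd h y) := by
  refine Prod.ext rfl ?_
  change y.2 - A.star.cartanForm (g.right.1 (h.right.1 y.1))
      (toAdd g.left + g.right.1 (toAdd h.left)) =
    y.2 - A.star.cartanForm (h.right.1 y.1) (toAdd h.left) -
      A.star.cartanForm (g.right.1 (h.right.1 y.1)) (toAdd g.left)
  rw [cartanForm_add_right, A.star_isNormalized.cartanForm_map]
  ring

/-- The action of `W(R_A) ⋉ K_0(R_A)` on the octopus lattice. -/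
def octopusRep (A : WeightTuple) :
    A.star.WeylSemidirect →* ((A.OctopusVertex → ℤ) ≃ₗ[ℤ] (A.OctopusVertex → ℤ)) :=
  (LinearMap.GeneralLinearGroup.generalLinearEquiv ℤ _).toMonoidHom.comp <| MonoidHom.toHomUnits
    { toFun := fun g =>
        A.octopusEquiv.symm.toLinearMap ∘ₗ affineEnd g ∘ₗ A.octopusEquiv.toLinearMap
      map_one' := by
        refine LinearMap.ext fun x => A.octopusEquiv.injective (Prod.ext ?_ ?_)
        · simp [affineEnd]
        · simp [affineEnd, cartanForm_zero_right]
      map_mul' := fun g h => LinearMap.ext fun x => by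
        simp [affineEnd_mul] }

theorem octopusEquiv_octopusRep (g : A.star.WeylSemidirect) (x : A.OctopusVertex → ℤ) :
    A.octopusEquiv (A.octopusRep g x) = affineEnd g (A.octopusEquiv x) :=
  A.octopusEquiv.apply_symm_apply _

theorem octopusRep_affineGen (v : A.OctopusVertex) :
    A.octopus.IsReflection (A.octopus.simpleRoot v) (A.octopusRep (A.affineGen v)) := by
  have hN := A.star_isNormalized
  intro x
  apply A.octopusEquiv.injective
  rw [octopusEquiv_octopusRep, octopusEquiv_apply, octopusEquiv_apply, map_sub, map_smul,
    octopus_cartanForm]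
  match v with
  | .base v =>
    rw [collapse_simpleRoot_base]
    refine Prod.ext (hN.simpleReflection_apply v _) ?_
    change x .starred - A.star.cartanForm _ 0 = x .starred - _ * 0
    rw [cartanForm_zero_right, mul_zero]
  | .starred =>
    rw [collapse_simpleRoot_starred]
    have hr : (A.affineGen .starred).right = hN.weylSimple .center := mul_one _
    -- Normal form puts the translation first, so `r_1 t_{α_1}` has lattice part `r_1 α_1`;
    -- invariance of the form then removes both copies of `r_1`.
    have hl : toAdd (A.affineGen .starred).left =
        hN.simpleReflection .center (A.star.simpleRoot .center) := zero_add _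
    refine Prod.ext ?_ ?_
    · change (A.affineGen .starred).right.1 _ = _
      rw [hr]
      exact hN.simpleReflection_apply _ _
    · change x .starred - A.star.cartanForm ((A.affineGen .starred).right.1 (A.collapse x))
        (toAdd (A.affineGen .starred).left) = x .starred - _ * A.octopus.simpleRoot .starred .starred
      rw [hr, hl, hN.coe_weylSimple, hN.cartanForm_simpleReflection, simpleRoot, simpleRoot,
        Pi.single_eq_same, mul_one]

theorem octopusRep_affineGen_eq (v : A.OctopusVertex) :
    A.octopusRep (A.affineGen v) = A.octopus_isNormalized.simpleReflection v :=
  (octopusRep_affineGen v).unique (A.octopus_isNormalized.isReflection v)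

theorem closure_range_affineGen (A : WeightTuple) :
    Subgroup.closure (Set.range A.affineGen) = ⊤ := by
  have h : A.affineGen = A.toAffine ∘ A.coxeterGen := funext fun v => (toAffine_coxeterGen v).symm
  rw [h, Set.range_comp, ← MonoidHom.map_closure]
  have h2 : Subgroup.closure (Set.range A.coxeterGen) = ⊤ := PresentedGroup.closure_range_of _
  rw [h2, ← MonoidHom.range_eq_map, MonoidHom.range_eq_top]
  exact A.toAffine_surjective

theorem octopusRep_range (A : WeightTuple) : A.octopusRep.range = A.octopus.weylGroup := by
  rw [A.octopus_isNormalized.weylGroup_eq, MonoidHom.range_eq_map, ← A.closure_range_affineGen,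
    MonoidHom.map_closure, ← Set.range_comp]
  exact congr_arg (fun F => Subgroup.closure (Set.range F)) (funext octopusRep_affineGen_eq)

/-- The projection of `W(R_A) ⋉ K_0(R_A)` onto the Weyl group of the octopus. -/
def octopusProj (A : WeightTuple) : A.star.WeylSemidirect →* A.octopus.weylGroup :=
  A.octopusRep.codRestrict _ fun g => A.octopusRep_range.le ⟨g, rfl⟩

theorem octopusProj_coe (g : A.star.WeylSemidirect) :
    (A.octopusProj g : (A.OctopusVertex → ℤ) ≃ₗ[ℤ] (A.OctopusVertex → ℤ)) = A.octopusRep g := rfl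

theorem octopusProj_surjective (A : WeightTuple) : Function.Surjective A.octopusProj := by
  rintro ⟨g, hg⟩
  rw [← octopusRep_range] at hg
  obtain ⟨h, rfl⟩ := hg
  exact ⟨h, rfl⟩

theorem mem_ker_octopusProj {g : A.star.WeylSemidirect} : g ∈ A.octopusProj.ker ↔
    g.right = 1 ∧ ∀ x, A.star.cartanForm x (toAdd g.left) = 0 := by
  have h : g ∈ A.octopusProj.ker ↔ ∀ y, affineEnd g y = y := by
    rw [MonoidHom.mem_ker, Subtype.ext_iff, octopusProj_coe]
    constructor
    · intro h y
      have := octopusEquiv_octopusRep g (A.octopusEquiv.symm y)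
      rw [LinearEquiv.apply_symm_apply] at this
      rw [← this, h]
      exact A.octopusEquiv.apply_symm_apply y
    · intro h
      ext1 x
      apply A.octopusEquiv.injective
      rw [octopusEquiv_octopusRep, h]
      rfl
  rw [h]
  constructor
  · intro h
    have h1 : g.right = 1 := Subtype.ext (LinearEquiv.ext fun x => congr_arg Prod.fst (h (x, 0)))
    refine ⟨h1, fun x => ?_⟩
    have h2 : 0 - A.star.cartanForm (g.right.1 x) (toAdd g.left) = 0 :=
      congr_arg Prod.snd (h (x, 0))
    rw [h1] at h2
    change 0 - A.star.cartanForm x _ = 0 at h2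
    linarith
  · rintro ⟨h1, h2⟩ y
    refine Prod.ext ?_ ?_
    · change g.right.1 y.1 = y.1
      rw [h1]
      rfl
    · change y.2 - A.star.cartanForm (g.right.1 y.1) (toAdd g.left) = y.2
      rw [h2, sub_zero]

/-! ### The radical of the star form and the kernel of the projection. -/

/-- Along an arm, a vector in the radical is an arithmetic progression. -/
theorem armCoord_of_radical {x : A.StarVertex → ℤ}
    (hx : ∀ v, A.star.cartanForm x (A.star.simpleRoot v) = 0) (i : Fin A.r) (j : ℕ)
    (hj : j < A.a i) :
    armCoord x i j = armCoord x i 0 + j * (armCoord x i 1 - armCoord x i 0) ∧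
    armCoord x i (j + 1) = armCoord x i 0 + (j + 1) * (armCoord x i 1 - armCoord x i 0) := by
  induction j with
  | zero => constructor <;> simp
  | succ j ih =>
    obtain ⟨h1, h2⟩ := ih (by omega)
    have := hx (.arm i ⟨j, by omega⟩)
    rw [star_cartanForm_arm] at this
    simp only at this
    refine ⟨by push_cast; exact h2, ?_⟩
    push_cast
    linear_combination (-1 : ℤ) * this + 2 * h2 - h1

/-- The progression continues to index `a_i`, one past the tip, where the padded coordinate is `0`.
-/
theorem armCoord_one_of_radical {x : A.StarVertex → ℤ}
    (hx : ∀ v, A.star.cartanForm x (A.star.simpleRoot v) = 0) (i : Fin A.r) :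
    x .center + A.a i * (armCoord x i 1 - x .center) = 0 := by
  have h2 := A.two_le_a i
  have h := (armCoord_of_radical hx i (A.a i - 1) (by omega)).2
  rw [armCoord_succ_of_le x i le_rfl] at h
  have hc : ((A.a i - 1 : ℕ) : ℤ) + 1 = A.a i := by omega
  rw [hc] at h
  exact h.symm

/-- The first coordinate on arm `i` is `x_1 (1 - 1 / a_i)`; substituting into `2 x_1 - ∑ x_{(i,1)} =
0` gives the claim. -/
theorem center_mul_chi_of_radical {x : A.StarVertex → ℤ}
    (hx : ∀ v, A.star.cartanForm x (A.star.simpleRoot v) = 0) : (x .center : ℚ) * A.chi = 0 := by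
  have h := hx .center
  rw [star_cartanForm_center] at h
  have h1 : ∀ i, (x (A.firstVertex i) : ℚ) = - (x .center * (1 / (A.a i : ℚ) - 1)) := by
    intro i
    have hi := armCoord_one_of_radical hx i
    rw [armCoord_one] at hi
    have ha : (A.a i : ℚ) ≠ 0 := by have := A.two_le_a i; positivity
    have hi' : (x .center : ℚ) + A.a i * (x (A.firstVertex i) - x .center) = 0 := by
      exact_mod_cast hi
    field_simp
    linear_combination hi'
  have h' : 2 * (x .center : ℚ) - ∑ i, (x (A.firstVertex i) : ℚ) = 0 := by exact_mod_cast h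
  rw [chi, mul_add, Finset.mul_sum]
  simp only [h1, Finset.sum_neg_distrib] at h'
  linear_combination h'

theorem eq_zero_of_radical {x : A.StarVertex → ℤ}
    (hx : ∀ v, A.star.cartanForm x (A.star.simpleRoot v) = 0) (hc : x .center = 0) : x = 0 := by
  ext v
  match v with
  | .center => exact hc
  | .arm i j =>
    have h1 := armCoord_one_of_radical hx i
    rw [hc, sub_zero, zero_add] at h1
    have ha : (A.a i : ℤ) ≠ 0 := by have := A.two_le_a i; omega
    have h2 := (mul_eq_zero.1 h1).resolve_left ha
    have h3 := (armCoord_of_radical hx i j (by omega)).2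
    have h0 : armCoord x i 0 = 0 := hc
    rw [armCoord_succ, h2, h0] at h3
    simpa using h3

/-- If `χ_A = 0`, the radical of the Cartan form is nonzero. -/
theorem exists_radical (h : A.chi = 0) : ∃ x : A.StarVertex → ℤ, x .center ≠ 0 ∧
    ∀ y, A.star.cartanForm y x = 0 := by
  have hd : ∀ i, ∃ d : ℤ, (∏ i, (A.a i : ℤ)) = A.a i * d := fun i =>
    Finset.dvd_prod_of_mem _ (Finset.mem_univ i)
  choose d hd using hd
  set N : ℤ := ∏ i, (A.a i : ℤ) with hN
  have ha : ∀ i, (A.a i : ℤ) ≠ 0 := fun i => by have := A.two_le_a i; omega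
  -- The progressions `N (1 - k / a_i)` solve the arm equations; taking `N = ∏ a_i` makes them
  -- integral, with `d i = N / a_i`. The vertex `arm i j` has index `k = j + 1`.
  let x : A.StarVertex → ℤ := fun v => match v with
    | .center => N
    | .arm i j => (A.a i - (j + 1)) * d i
  have hX : ∀ i j, j ≤ A.a i → armCoord x i j = (A.a i - j) * d i := by
    intro i j hj
    match j with
    | 0 =>
      change N = _
      rw [hd i]
      simp
    | j + 1 =>
      by_cases hj' : j < A.a i - 1
      · rw [armCoord_succ_of_lt x i hj']
        simp [x]
      · have : j + 1 = A.a i := by omega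
        rw [armCoord_succ_of_le x i (not_lt.1 hj'), this, sub_self, zero_mul]
  refine ⟨x, Finset.prod_ne_zero_iff.2 fun i _ => ha i, ?_⟩
  have hv : ∀ v, A.star.cartanForm x (A.star.simpleRoot v) = 0 := by
    intro v
    match v with
    | .center =>
      rw [star_cartanForm_center]
      have h1 : ∀ i, (x (A.firstVertex i) : ℚ) = - (N * (1 / (A.a i : ℚ) - 1)) := by
        intro i
        rw [← armCoord_one x, hX i 1 (by have := A.two_le_a i; omega)]
        have ha' : (A.a i : ℚ) ≠ 0 := by exact_mod_cast ha i
        have hd' : (N : ℚ) = A.a i * d i := by exact_mod_cast hd i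
        rw [hd']
        push_cast
        field_simp
        ring
      have h2 : (2 * (N : ℚ) - ∑ i, (x (A.firstVertex i) : ℚ)) = 0 := by
        simp only [h1, Finset.sum_neg_distrib, ← Finset.mul_sum]
        rw [chi] at h
        linear_combination (N : ℚ) * h
      change 2 * N - _ = 0
      exact_mod_cast h2
    | .arm i j =>
      have := j.2
      rw [star_cartanForm_arm, hX i _ (by omega), hX i _ (by omega), hX i _ (by omega)]
      push_cast
      ring
  have hfun : A.star.cartanFunctional x = 0 := by
    refine LinearMap.pi_ext' fun v => LinearMap.ext_ring ?_
    change A.star.cartanForm (A.star.simpleRoot v) x = 0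
    rw [cartanForm_comm, hv]
  exact fun y => LinearMap.congr_fun hfun y

theorem octopusProj_injective (h : A.chi ≠ 0) : Function.Injective A.octopusProj := by
  rw [← MonoidHom.ker_eq_bot_iff, eq_bot_iff]
  intro g hg
  obtain ⟨h1, h2⟩ := mem_ker_octopusProj.1 hg
  have hx : ∀ v, A.star.cartanForm (toAdd g.left) (A.star.simpleRoot v) = 0 := fun v => by
    rw [cartanForm_comm, h2]
  have hc := (mul_eq_zero.1 (center_mul_chi_of_radical hx)).resolve_right h
  exact SemidirectProduct.ext (eq_zero_of_radical hx (by exact_mod_cast hc)) h1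

theorem weyl_fixes_radical {x : A.StarVertex → ℤ} (hx : ∀ y, A.star.cartanForm y x = 0)
    (w : A.star.weylGroup) : w.1 x = x := by
  have hw := w.2
  revert hw
  generalize w.1 = w
  intro hw
  rw [A.star_isNormalized.weylGroup_eq] at hw
  induction hw using Subgroup.closure_induction with
  | mem g hg =>
    obtain ⟨v, rfl⟩ := hg
    rw [IsNormalized.simpleReflection_apply, cartanForm_comm, hx, zero_smul, sub_zero]
  | one => rfl
  | mul g h _ _ hg hh => rw [LinearEquiv.mul_apply, hh, hg]
  | inv g _ hg => exact (LinearEquiv.symm_apply_eq g).2 hg.symm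

/-- The kernel consists of translations by radical vectors, which every reflection fixes. -/
theorem ker_octopusProj_le_center (A : WeightTuple) :
    A.octopusProj.ker ≤ Subgroup.center A.star.WeylSemidirect := by
  intro z hz
  obtain ⟨h1, h2⟩ := mem_ker_octopusProj.1 hz
  rw [Subgroup.mem_center_iff]
  intro g
  refine SemidirectProduct.ext ?_ ?_
  · rw [SemidirectProduct.mul_left, SemidirectProduct.mul_left, h1, map_one, MulAut.one_apply]
    have : A.star.weylAction g.right z.left = z.left := weyl_fixes_radical h2 g.right
    rw [this, mul_comm]
  · rw [SemidirectProduct.mul_right, SemidirectProduct.mul_right, h1, one_mul, mul_one]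

/-- The central coordinate on the kernel of the projection. -/
def kerCoord (A : WeightTuple) : A.octopusProj.ker →* Multiplicative ℤ where
  toFun z := ofAdd (toAdd z.1.left .center)
  map_one' := rfl
  map_mul' y z := by
    have h : y.1.right = 1 := (mem_ker_octopusProj.1 y.2).1
    rw [Subgroup.coe_mul, SemidirectProduct.mul_left, h, map_one]
    rfl

theorem kerCoord_injective (A : WeightTuple) : Function.Injective A.kerCoord := by
  rw [injective_iff_map_eq_one]
  rintro ⟨z, hz⟩ h
  obtain ⟨h1, h2⟩ := mem_ker_octopusProj.1 hz
  have hx : ∀ v, A.star.cartanForm (toAdd z.left) (A.star.simpleRoot v) = 0 := fun v => by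
    rw [cartanForm_comm, h2]
  exact Subtype.ext (SemidirectProduct.ext (eq_zero_of_radical hx h) h1)

/-- The central coordinate embeds the kernel in `ℤ`, so it is cyclic; the radical vector has nonzero
central coordinate, so it is infinite. -/
theorem nonempty_ker_equiv (h : A.chi = 0) :
    Nonempty (A.octopusProj.ker ≃* Multiplicative ℤ) := by
  obtain ⟨x, hx, hrad⟩ := exists_radical h
  have := isCyclic_of_injective A.kerCoord A.kerCoord_injective
  have : Infinite A.octopusProj.ker := by
    by_contra hfin
    rw [not_infinite_iff_finite] at hfin
    let z : A.octopusProj.ker :=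
      ⟨A.star.translation x, mem_ker_octopusProj.2 ⟨rfl, hrad⟩⟩
    have hz := A.kerCoord.isOfFinOrder (isOfFinOrder_of_finite z)
    rw [isOfFinOrder_iff_eq_one] at hz
    exact hx (congr_arg toAdd hz)
  exact ⟨intCyclicMulEquiv.symm⟩

/-- The group is generated by involutions and `ℤ` has no 2-torsion. -/
theorem affine_hom_int_trivial (F : A.star.WeylSemidirect →* Multiplicative ℤ) : F = 1 := by
  refine MonoidHom.eq_of_eqOn_dense A.closure_range_affineGen ?_
  rintro _ ⟨v, rfl⟩
  have h : A.affineGen v * A.affineGen v = 1 := by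
    rw [← toAffine_coxeterGen, ← map_mul, coxeterGen_mul_self, map_one]
  have h2 : toAdd (F (A.affineGen v)) + toAdd (F (A.affineGen v)) = 0 := by
    rw [← toAdd_mul, ← map_mul, h, map_one, toAdd_one]
  apply toAdd.injective
  change _ = 0
  omega

theorem octopusProj_isNontrivialCentralExtension (h : A.chi = 0) :
    IsNontrivialCentralExtensionByInt A.octopusProj := by
  obtain ⟨e⟩ := nonempty_ker_equiv h
  exact ⟨A.octopusProj_surjective, A.ker_octopusProj_le_center, ⟨e⟩,
    not_split_of_hom_int_trivial A.ker_octopusProj_le_center e affine_hom_int_trivial⟩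

end WeightTuple

theorem theorem4 (A : WeightTuple) :
    ∃ Φ : A.OctopusCoxeterGroup ≃* A.star.WeylSemidirect,
      -- `Φ` maps the generator `w̃_v` to the simple reflection `r_v` for every vertex `v` of `T_A`
      (∀ v : A.StarVertex, (Φ (A.coxeterGen (.base v))).left = 1 ∧
        A.star.IsReflection (A.star.simpleRoot v) (Φ (A.coxeterGen (.base v))).right) ∧
      -- `Φ` maps `σ_1 = w̃_1 w̃_{1*}` to the translation by `α_1`
      Φ (A.coxeterGen (.base .center) * A.coxeterGen .starred) =
        SemidirectProduct.inl (Multiplicative.ofAdd (A.star.simpleRoot .center)) ∧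
      (A.chi ≠ 0 → ∃ Ψ : A.OctopusCoxeterGroup ≃* A.octopus.weylGroup,
        ∀ v, A.octopus.IsReflection (A.octopus.simpleRoot v) (Ψ (A.coxeterGen v))) ∧
      (A.chi = 0 → ∃ π : A.star.WeylSemidirect →* A.octopus.weylGroup,
        IsNontrivialCentralExtensionByInt π ∧
        ∀ v, A.octopus.IsReflection (A.octopus.simpleRoot v) (π (Φ (A.coxeterGen v)))) := by
  obtain ⟨Φ, hΦ⟩ := A.exists_affineEquiv
  refine ⟨Φ, fun v => ?_, ?_, fun h => ?_, fun h => ?_⟩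
  · rw [hΦ]
    exact ⟨rfl, A.star_isNormalized.isReflection v⟩
  · rw [map_mul, hΦ, hΦ]
    exact A.star_isNormalized.affineSimple_mul_self_mul _ _
  · refine ⟨Φ.trans (MulEquiv.ofBijective A.octopusProj
      ⟨WeightTuple.octopusProj_injective h, A.octopusProj_surjective⟩), fun v => ?_⟩
    change A.octopus.IsReflection _ (A.octopusProj (Φ (A.coxeterGen v))).1
    rw [hΦ]
    exact WeightTuple.octopusRep_affineGen v
  · refine ⟨A.octopusProj, WeightTuple.octopusProj_isNontrivialCentralExtension h, fun v => ?_⟩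
    rw [hΦ]
    exact WeightTuple.octopusRep_affineGen v
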